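/- Let $n\ge 0$ be an integer and let $\mathcal D$ be the set of dyadic intervals $I=[k2^{-m},(k+1)2^{-m})$, $k,m\in\mathbb Z$. For $I\in\mathcal D$ let $h_I=|I|^{-1/2}(\chi_{I_-}-\chi_{I_+})$ be its Haar function, where $I_-$ and $I_+$ are the right and the left half of $I$; for a locally integrable $f:\mathbb R\to\mathbb C^n$ put $f_I=\int_{\mathbb R} f\,h_I\,dx$, and for a locally integrable matrix-valued function $W$ put $\langle W\rangle_I=|I|^{-1}\int_I W(x)\,dx$. A matrix weight is a measurable function $W:\mathbb R\to\mathbb C^{n\times n}$ whose values are positive and invertible (i.e. positive definite) almost everywhere. **Theorem.** Let $U$ and $V^{-1}$ be locally integrable matrix weights such that (i) $U$ satisfies the dyadic reverse Hölder inequality: there are constants $C>0$ and $r>2$ such that $$\int_I \bigl\|U(x)^{1/2}\langle U\rangle_I^{-1/2}y\bigr\|^r\,dx\le C\,|I|\,\|y\|^r$$ for all $I\in\mathcal D$ and all nonzero $y\in\mathbb C^n$; (ii) $(U,V)$ satisfies the dyadic joint $A_2$ condition: there is a constant $C$ such that, as an inequality between Hermitian matrices, $$\langle V^{-1}\rangle_I^{1/2}\,\langle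 U\rangle_I\,\langle V^{-1}\rangle_I^{1/2}<C\cdot \mathrm{Id}\qquad\text{for all } I\in\mathcal D.$$ Define $S=M_U^{1/2}D_{V^{-1}}$ on functions $f$ with finite Haar expansion $f=\sum_I f_I h_I$ by $$Sf(x)=U(x)^{1/2}\sum_{I\in\mathcal D}\langle V^{-1}\rangle_I^{1/2}f_I\,h_I(x).$$ Then $S$ is bounded on the unweighted space $L^2(\mathbb R,\mathbb C^n)$: there is exactly one bounded linear operator $T:L^2(\mathbb R,\mathbb C^n)\to L^2(\mathbb R,\mathbb C^n)$ such that $Tf=Sf$ almost everywhere for every $f\in L^2(\mathbb R,\mathbb C^n)$ with finite Haar expansion. -/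

import Mathlib

open MeasureTheory
open scoped ENNReal ComplexOrder MatrixOrder

noncomputable section

namespace MatrixWeights

/-- The space `ℂⁿ` with its Hermitian (Euclidean) norm. -/
abbrev Cn (n : ℕ) := EuclideanSpace ℂ (Fin n)

/-- The action of a complex `n × n` matrix on `ℂⁿ`, `v ↦ A v`. -/
def act {n : ℕ} (A : Matrix (Fin n) (Fin n) ℂ) (v : Cn n) : Cn n :=
  Matrix.toEuclideanCLM (n := Fin n) (𝕜 := ℂ) A v

/-- A matrix weight: a measurable matrix-valued function on `ℝ` that is positive and invertible,
i.e. positive definite, almost everywhere. -/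
structure IsMatrixWeight {n : ℕ} (W : ℝ → Matrix (Fin n) (Fin n) ℂ) : Prop where
  measurable : ∀ i j, AEMeasurable (fun x => W x i j) volume
  posDef : ∀ᵐ x ∂(volume : Measure ℝ), (W x).PosDef

/-- Local integrability of a matrix-valued function, i.e. of each of its entries. -/
def IsLocIntegrable {n : ℕ} (W : ℝ → Matrix (Fin n) (Fin n) ℂ) : Prop :=
  ∀ i j, LocallyIntegrable (fun x => W x i j) volume

/-- Dyadic intervals are indexed by pairs `(m, k)` of integers: the pair `(m, k)` stands for
`[k 2⁻ᵐ, (k + 1) 2⁻ᵐ)`. Distinct pairs give distinct intervals. -/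
abbrev DyadicInterval := ℤ × ℤ

namespace DyadicInterval

/-- The dyadic interval `[k 2⁻ᵐ, (k + 1) 2⁻ᵐ)` as a subset of `ℝ`. -/
def toSet (I : DyadicInterval) : Set ℝ :=
  Set.Ico ((I.2 : ℝ) * (2 : ℝ) ^ (-I.1)) (((I.2 : ℝ) + 1) * (2 : ℝ) ^ (-I.1))

/-- The length `|I| = 2⁻ᵐ`. -/
def length (I : DyadicInterval) : ℝ := (2 : ℝ) ^ (-I.1)

/-- The left half of a dyadic interval. -/
def leftHalf (I : DyadicInterval) : DyadicInterval := (I.1 + 1, 2 * I.2)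

/-- The right half of a dyadic interval. -/
def rightHalf (I : DyadicInterval) : DyadicInterval := (I.1 + 1, 2 * I.2 + 1)

end DyadicInterval

/-- The Haar function `h_I = |I|^{-1/2} (χ_{right half of I} - χ_{left half of I})`. -/
def haar (I : DyadicInterval) (x : ℝ) : ℝ :=
  (Real.sqrt I.length)⁻¹ *
    (I.rightHalf.toSet.indicator (fun _ => (1 : ℝ)) x
      - I.leftHalf.toSet.indicator (fun _ => (1 : ℝ)) x)

/-- The Haar coefficient `f_I = ∫ f h_I ∈ ℂⁿ`. -/
def haarCoeff {n : ℕ} (f : ℝ → Cn n) (I : DyadicInterval) : Cn n :=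
  ∫ x, haar I x • f x

/-- `f` has a finite Haar expansion: `f = ∑_{I ∈ F} f_I h_I` a.e. for some finite set `F` of
dyadic intervals. -/
def HasFiniteHaarExpansion {n : ℕ} (f : ℝ → Cn n) : Prop :=
  ∃ F : Finset DyadicInterval,
    f =ᵐ[volume] fun x => ∑ I ∈ F, haar I x • haarCoeff f I

/-- The mean value `⟨W⟩_I = |I|⁻¹ ∫_I W(x) dx`, taken entrywise. -/
def avg {n : ℕ} (W : ℝ → Matrix (Fin n) (Fin n) ℂ) (I : DyadicInterval) : Matrix (Fin n) (Fin n) ℂ :=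
  Matrix.of fun i j => ((I.length)⁻¹ : ℝ) • ∫ x in I.toSet, W x i j

/-- The dyadic reverse Hölder inequality: there are `C > 0` and `r > 2` such that
`∫_I ‖U(x)^{1/2} ⟨U⟩_I^{-1/2} y‖^r dx ≤ C |I| ‖y‖^r` for all dyadic `I` and all nonzero `y`.
The integral is that of a nonnegative function, so that its finiteness is part of the claim. -/
def DyadicReverseHolder {n : ℕ} (U : ℝ → Matrix (Fin n) (Fin n) ℂ) : Prop :=
  ∃ C : ℝ, 0 < C ∧ ∃ r : ℝ, 2 < r ∧ ∀ (I : DyadicInterval) (y : Cn n), y ≠ 0 →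
    ∫⁻ x in I.toSet,
        ENNReal.ofReal (‖act (CFC.sqrt (U x) * (CFC.sqrt (avg U I))⁻¹) y‖ ^ r)
      ≤ ENNReal.ofReal (C * I.length * ‖y‖ ^ r)

/-- The dyadic joint `A₂` condition for the pair `(U, V)`, in terms of `U` and `W = V⁻¹`: there is
a constant `C` with `⟨W⟩_I^{1/2} ⟨U⟩_I ⟨W⟩_I^{1/2} < C · 1` (as Hermitian matrices, i.e. the
difference is positive definite) for all dyadic `I`. -/
def DyadicJointA2 {n : ℕ} (U W : ℝ → Matrix (Fin n) (Fin n) ℂ) : Prop :=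
  ∃ C : ℝ, ∀ I : DyadicInterval,
    ((C : ℂ) • (1 : Matrix (Fin n) (Fin n) ℂ)
      - CFC.sqrt (avg W I) * avg U I * CFC.sqrt (avg W I)).PosDef

/-- The operator `D_W : ∑ f_I h_I ↦ ∑ ⟨W⟩_I^{1/2} f_I h_I` on functions with finite Haar expansion
(for such functions only finitely many terms of the sum are nonzero). -/
def haarMultiplier {n : ℕ} (W : ℝ → Matrix (Fin n) (Fin n) ℂ) (f : ℝ → Cn n) (x : ℝ) : Cn n :=
  ∑ᶠ I : DyadicInterval, haar I x • act (CFC.sqrt (avg W I)) (haarCoeff f I)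

/-- The two-weighted square function `S = M_U^{1/2} D_{V⁻¹}` on functions with finite Haar
expansion: `(S f)(x) = U(x)^{1/2} (D_{V⁻¹} f)(x)`. -/
def squareFunction {n : ℕ} (U V : ℝ → Matrix (Fin n) (Fin n) ℂ) (f : ℝ → Cn n) (x : ℝ) : Cn n :=
  act (CFC.sqrt (U x)) (haarMultiplier (fun t => (V t)⁻¹) f x)

end MatrixWeights

end

noncomputable section

namespace MatrixWeights

/-! Write W = V⁻¹ and b_J = ⟨W⟩_J^{1/2} a_J. By Parseval and density of finite Haar sums it suffices
to bound ∫ ‖U^{1/2} ∑ h_J b_J‖² by a constant times ∑ ‖a_J‖² (`exists_lintegral_squareFunction_le`).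
If U were comparable to a constant matrix ⟨U⟩_T, orthogonality would leave ∑ ‖⟨U⟩_T^{1/2}
⟨W⟩_J^{1/2} a_J‖². A stopping time produces families of intervals on which this comparison is good
enough.

The quantity `spread U W T I` controls both ⟨U⟩_I against ⟨U⟩_T and the operator ⟨U⟩_T^{1/2}
⟨W⟩_I^{1/2}. It is a dyadic martingale in I, and joint A₂ bounds it by some κ at I = T. Below T, an
interval where it exceeds 2κ stops and becomes the top of a new tree. The martingale property makes
nested stopping intervals rare: the weight w = (3/2)^s, with s the number of stops above x, has mean
at most 4 on the starting interval (`lintegral_stoppingWeight_le`).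

Reverse Hölder turns this into decay between trees. With θ = 1 - 2/r, Young's inequality gives ∫_I
w^θ ‖U^{1/2} v‖² ≤ (4 + C) |I| ‖⟨U⟩_I^{1/2} v‖² (`lintegral_rpow_mul_norm_act_sq_le`). Each stop
thus pays a factor (3/2)^θ = 1 + ε, exactly what ‖z + c‖² ≤ (1 + ε)‖z‖² + (1 + ε⁻¹)‖c‖² costs when
the contribution c of a finished tree is added to the contribution z of the earlier ones. An
induction on depth combines this with the parallelogram law, which plays the role of orthogonality
inside a tree (`lintegral_norm_act_localHaarSum_sq_le`).

The constants do not depend on the depth or the number of coefficients. The operator is then the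
continuous extension from finite Haar sums, and completeness of the Haar system gives existence and
uniqueness on all of L². -/

/-- The quadratic form `v ↦ Re ⟨v, A v⟩`. -/
def quad {n : ℕ} (A : Matrix (Fin n) (Fin n) ℂ) (v : Cn n) : ℝ := (inner ℂ v (act A v)).re

/-! ### Matrices acting on ℂⁿ: quadratic forms and square roots. -/

variable {n : ℕ}

lemma act_mul (A B : Matrix (Fin n) (Fin n) ℂ) (v : Cn n) : act (A * B) v = act A (act B v) := by
  simp [act]

lemma act_one (v : Cn n) : act 1 v = v := by simp [act]

lemma act_add (A : Matrix (Fin n) (Fin n) ℂ) (v w : Cn n) : act A (v + w) = act A v + act A w :=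
  map_add _ _ _

lemma act_smul (A : Matrix (Fin n) (Fin n) ℂ) (c : ℂ) (v : Cn n) : act A (c • v) = c • act A v :=
  map_smul _ _ _

lemma act_smul_real (A : Matrix (Fin n) (Fin n) ℂ) (c : ℝ) (v : Cn n) :
    act A (c • v) = c • act A v := by
  simp [act]

lemma act_zero (A : Matrix (Fin n) (Fin n) ℂ) : act A 0 = 0 := map_zero _

lemma act_sum {ι : Type*} (A : Matrix (Fin n) (Fin n) ℂ) (s : Finset ι) (v : ι → Cn n) :
    act A (∑ i ∈ s, v i) = ∑ i ∈ s, act A (v i) := map_sum _ _ _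

lemma inner_act_left {A : Matrix (Fin n) (Fin n) ℂ} (hA : A.IsHermitian) (v w : Cn n) :
    inner ℂ (act A v) w = inner ℂ v (act A w) := by
  have h : ContinuousLinearMap.adjoint (Matrix.toEuclideanCLM (n := Fin n) (𝕜 := ℂ) A) =
      Matrix.toEuclideanCLM (n := Fin n) (𝕜 := ℂ) A := by
    rw [← ContinuousLinearMap.star_eq_adjoint, ← map_star, Matrix.star_eq_conjTranspose, hA.eq]
  unfold act
  conv_lhs => rw [← h]
  rw [ContinuousLinearMap.adjoint_inner_left]

lemma quad_eq_sum (A : Matrix (Fin n) (Fin n) ℂ) (v : Cn n) :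
    quad A v = (∑ i, ∑ j, (star (v i) * v j) * A i j).re := by
  unfold quad act
  rw [PiLp.inner_apply]
  congr 1
  refine Finset.sum_congr rfl fun i _ => ?_
  simp only [Matrix.ofLp_toEuclideanCLM, Matrix.mulVec, dotProduct, RCLike.inner_apply,
    Finset.sum_mul]
  refine Finset.sum_congr rfl fun j _ => ?_
  simp only [RCLike.star_def]
  ring

lemma isHermitian_sqrt (A : Matrix (Fin n) (Fin n) ℂ) : (CFC.sqrt A).IsHermitian :=
  (Matrix.nonneg_iff_posSemidef.1 (CFC.sqrt_nonneg A)).1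

lemma sqrt_mul_sqrt {A : Matrix (Fin n) (Fin n) ℂ} (hA : A.PosSemidef) :
    CFC.sqrt A * CFC.sqrt A = A :=
  CFC.sqrt_mul_sqrt_self A (Matrix.nonneg_iff_posSemidef.2 hA)

lemma norm_act_sqrt_sq {A : Matrix (Fin n) (Fin n) ℂ} (hA : A.PosSemidef) (v : Cn n) :
    ‖act (CFC.sqrt A) v‖ ^ 2 = quad A v := by
  have h := inner_act_left (isHermitian_sqrt A) v (act (CFC.sqrt A) v)
  rw [← act_mul, sqrt_mul_sqrt hA, inner_self_eq_norm_sq_to_K] at h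
  unfold quad
  rw [← h]
  norm_cast

lemma quad_nonneg {A : Matrix (Fin n) (Fin n) ℂ} (hA : A.PosSemidef) (v : Cn n) : 0 ≤ quad A v := by
  rw [← norm_act_sqrt_sq hA]; positivity

lemma quad_eq_dotProduct (A : Matrix (Fin n) (Fin n) ℂ) (v : Cn n) :
    quad A v = (star (v.ofLp) ⬝ᵥ (A.mulVec v.ofLp)).re := by
  rw [quad_eq_sum]
  congr 1
  simp only [dotProduct, Matrix.mulVec, Finset.mul_sum, Pi.star_apply]
  refine Finset.sum_congr rfl fun i _ => Finset.sum_congr rfl fun j _ => by ring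

lemma quad_pos {A : Matrix (Fin n) (Fin n) ℂ} (hA : A.PosDef) {v : Cn n} (hv : v ≠ 0) :
    0 < quad A v := by
  rw [quad_eq_dotProduct]
  exact hA.re_dotProduct_pos (x := v.ofLp) (by simpa using hv)

lemma isUnit_sqrt {A : Matrix (Fin n) (Fin n) ℂ} (hA : A.PosDef) : IsUnit (CFC.sqrt A) := by
  have h := hA.isUnit
  rw [← sqrt_mul_sqrt hA.posSemidef] at h
  exact isUnit_of_mul_isUnit_left h

lemma act_sqrt_inv_act_sqrt {A : Matrix (Fin n) (Fin n) ℂ} (hA : A.PosDef) (v : Cn n) :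
    act (CFC.sqrt A)⁻¹ (act (CFC.sqrt A) v) = v := by
  rw [← act_mul, Matrix.nonsing_inv_mul _ ((Matrix.isUnit_iff_isUnit_det _).1 (isUnit_sqrt hA)),
    act_one]

lemma act_sqrt_act_sqrt_inv {A : Matrix (Fin n) (Fin n) ℂ} (hA : A.PosDef) (v : Cn n) :
    act (CFC.sqrt A) (act (CFC.sqrt A)⁻¹ v) = v := by
  rw [← act_mul, Matrix.mul_nonsing_inv _ ((Matrix.isUnit_iff_isUnit_det _).1 (isUnit_sqrt hA)),
    act_one]

/-- The operator norm is at most the Hilbert--Schmidt norm. -/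
lemma norm_act_sq_le (B : Matrix (Fin n) (Fin n) ℂ) (v : Cn n) :
    ‖act B v‖ ^ 2 ≤ (∑ i, ‖act B (EuclideanSpace.single i 1)‖ ^ 2) * ‖v‖ ^ 2 := by
  have hv : v = ∑ i, v i • EuclideanSpace.single i (1 : ℂ) := by
    ext j
    simp [Finset.sum_apply, Pi.single_apply]
  have h1 : ‖act B v‖ ≤ ∑ i, ‖act B (EuclideanSpace.single i 1)‖ * ‖v i‖ := by
    conv_lhs => rw [hv]
    rw [act_sum]
    refine (norm_sum_le _ _).trans (Finset.sum_le_sum fun i _ => ?_)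
    rw [act_smul, norm_smul, mul_comm]
  calc ‖act B v‖ ^ 2 ≤ (∑ i, ‖act B (EuclideanSpace.single i 1)‖ * ‖v i‖) ^ 2 := by gcongr
    _ ≤ (∑ i, ‖act B (EuclideanSpace.single i 1)‖ ^ 2) * ∑ i, ‖v i‖ ^ 2 :=
      Finset.sum_mul_sq_le_sq_mul_sq _ _ _
    _ = _ := by rw [EuclideanSpace.norm_sq_eq v]

/-- For Hermitian `A`, `B`, a bound for `A B` is a bound for `B A`. -/
lemma norm_act_act_sq_le_swap {A B : Matrix (Fin n) (Fin n) ℂ} (hA : A.IsHermitian)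
    (hB : B.IsHermitian) {c : ℝ} (v : Cn n)
    (h : ∀ w, ‖act A (act B w)‖ ^ 2 ≤ c * ‖w‖ ^ 2) :
    ‖act B (act A v)‖ ^ 2 ≤ c * ‖v‖ ^ 2 := by
  set w := act B (act A v) with hw
  -- Duality: for w = B A v, ⟨w, w⟩ = ⟨v, A B w⟩, and the bound for A B applies to w.
  have h1 : ‖w‖ ^ 2 ≤ ‖v‖ * ‖act A (act B w)‖ := by
    have h2 : inner ℂ w w = inner ℂ v (act A (act B w)) := by
      conv_lhs => rw [hw]
      rw [inner_act_left hB, inner_act_left hA]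
    have h3 : ‖inner ℂ w w‖ = ‖w‖ ^ 2 := by
      rw [inner_self_eq_norm_sq_to_K]; simp
    rw [← h3, h2]
    exact norm_inner_le_norm _ _
  rcases eq_or_ne w 0 with h0 | h0
  · have hc := (sq_nonneg _).trans (h v)
    rw [h0]; simpa using hc
  have hw0 : 0 < ‖w‖ := norm_pos_iff.2 h0
  have h4 : (‖w‖ ^ 2) ^ 2 ≤ ‖v‖ ^ 2 * (c * ‖w‖ ^ 2) := by
    calc (‖w‖ ^ 2) ^ 2 ≤ (‖v‖ * ‖act A (act B w)‖) ^ 2 := by gcongr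
      _ = ‖v‖ ^ 2 * ‖act A (act B w)‖ ^ 2 := by ring
      _ ≤ _ := by gcongr; exact h w
  have h5 : 0 < ‖w‖ ^ 2 := by positivity
  nlinarith

/-! ### Measurability of the square root of a weight. -/

open scoped Matrix.Norms.L2Operator in
lemma continuousOn_sqrt :
    ContinuousOn (CFC.sqrt : Matrix (Fin n) (Fin n) ℂ → Matrix (Fin n) (Fin n) ℂ) {A | 0 ≤ A} :=
  CFC.continuousOn_sqrt

lemma isClosed_nonneg_matrix : IsClosed {A : Matrix (Fin n) (Fin n) ℂ | 0 ≤ A} := by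
  have : {A : Matrix (Fin n) (Fin n) ℂ | 0 ≤ A} =
      {A | A.conjTranspose = A} ∩ ⋂ v : Fin n → ℂ, {A | 0 ≤ star v ⬝ᵥ A.mulVec v} := by
    ext A
    simp only [Set.mem_ofPred_eq, Matrix.nonneg_iff_posSemidef, Set.mem_inter_iff, Set.mem_iInter,
      Matrix.posSemidef_iff_dotProduct_mulVec, Matrix.IsHermitian]
  rw [this]
  refine (isClosed_eq (by fun_prop) continuous_id).inter (isClosed_iInter fun v => ?_)
  refine isClosed_le continuous_const ?_
  fun_prop

/-- The square root is continuous only on the closed cone of positive semidefinite matrices.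
Extended by 0 it is Borel, and the weight lies in the cone almost everywhere. -/
lemma aemeasurable_sqrt_entry {U : ℝ → Matrix (Fin n) (Fin n) ℂ} (hU : IsMatrixWeight U)
    (i j : Fin n) : AEMeasurable (fun x => CFC.sqrt (U x) i j) volume := by
  classical
  let : MeasurableSpace (Matrix (Fin n) (Fin n) ℂ) := borel _
  have : BorelSpace (Matrix (Fin n) (Fin n) ℂ) := ⟨rfl⟩
  have hm : AEMeasurable U volume := by
    have h1 : AEMeasurable (fun x => (fun i j => U x i j : Fin n → Fin n → ℂ)) volume :=
      aemeasurable_pi_lambda _ fun i => aemeasurable_pi_lambda _ fun j => hU.measurable i j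
    have h2 : Continuous (Matrix.of : (Fin n → Fin n → ℂ) → Matrix (Fin n) (Fin n) ℂ) :=
      continuous_id
    exact h2.measurable.comp_aemeasurable h1
  have hF : Measurable (Set.piecewise {A : Matrix (Fin n) (Fin n) ℂ | 0 ≤ A} CFC.sqrt 0) :=
    continuousOn_sqrt.measurable_piecewise continuousOn_const isClosed_nonneg_matrix.measurableSet
  have he : Measurable fun A : Matrix (Fin n) (Fin n) ℂ => A i j :=
    (continuous_id.matrix_elem i j).measurable
  refine ((he.comp hF).comp_aemeasurable hm).congr ?_
  filter_upwards [hU.posDef] with x hx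
  simp [Matrix.nonneg_iff_posSemidef.2 hx.posSemidef]

lemma aemeasurable_act_sqrt {U : ℝ → Matrix (Fin n) (Fin n) ℂ} (hU : IsMatrixWeight U)
    {g : ℝ → Cn n} (hg : AEMeasurable g volume) :
    AEMeasurable (fun x => act (CFC.sqrt (U x)) (g x)) volume := by
  have h1 : AEMeasurable (fun x => (act (CFC.sqrt (U x)) (g x)).ofLp) volume := by
    refine aemeasurable_pi_lambda _ fun i => ?_
    simp only [act, Matrix.ofLp_toEuclideanCLM, Matrix.mulVec, dotProduct]
    refine Finset.aemeasurable_fun_sum _ fun j _ => (aemeasurable_sqrt_entry hU i j).mul ?_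
    exact (by fun_prop : Measurable fun v : Cn n => v j).comp_aemeasurable hg
  exact (PiLp.continuous_toLp 2 _).measurable.comp_aemeasurable h1

/-! ### Dyadic intervals and Haar functions. -/

namespace DyadicInterval

/-- The number `k` with `x ∈ [k 2⁻ᵐ, (k + 1) 2⁻ᵐ)`. -/
def index (m : ℤ) (x : ℝ) : ℤ := ⌊x * (2 : ℝ) ^ m⌋

lemma mem_toSet_iff (I : DyadicInterval) (x : ℝ) : x ∈ I.toSet ↔ index I.1 x = I.2 := by
  have h : (0 : ℝ) < 2 ^ I.1 := by positivity
  unfold toSet index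
  rw [Int.floor_eq_iff, Set.mem_Ico, zpow_neg, ← div_eq_mul_inv, ← div_eq_mul_inv,
    div_le_iff₀ h, lt_div_iff₀ h]

/-- Integer division rounds down, so halving the index gives the dyadic parent for negative indices
too. -/
lemma index_eq_index_succ_div (m : ℤ) (x : ℝ) : index m x = index (m + 1) x / 2 := by
  unfold index
  have h : x * (2 : ℝ) ^ m = (x * (2 : ℝ) ^ (m + 1)) / (2 : ℕ) := by
    rw [zpow_add_one₀ two_ne_zero]; push_cast; ring
  rw [h, Int.floor_div_natCast]
  rfl

lemma index_eq_of_le {m m' : ℤ} (hm : m ≤ m') {x y : ℝ} (h : index m' x = index m' y) :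
    index m x = index m y := by
  induction m, hm using Int.leInductionDown with
  | base => exact h
  | pred k _ ih =>
    rw [index_eq_index_succ_div, index_eq_index_succ_div (k - 1) y, sub_add_cancel, ih]

lemma mem_toSet_index (m : ℤ) (x : ℝ) : x ∈ toSet (m, index m x) := (mem_toSet_iff _ _).2 rfl

lemma mem_leftHalf_or_mem_rightHalf_iff (I : DyadicInterval) (x : ℝ) :
    x ∈ I.leftHalf.toSet ∨ x ∈ I.rightHalf.toSet ↔ x ∈ I.toSet := by
  simp only [mem_toSet_iff, leftHalf, rightHalf, index_eq_index_succ_div I.1]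
  omega

lemma toSet_eq_union (I : DyadicInterval) : I.toSet = I.leftHalf.toSet ∪ I.rightHalf.toSet := by
  ext x; exact (mem_leftHalf_or_mem_rightHalf_iff I x).symm

lemma disjoint_halves (I : DyadicInterval) : Disjoint I.leftHalf.toSet I.rightHalf.toSet := by
  rw [Set.disjoint_left]
  intro x
  simp only [mem_toSet_iff, leftHalf, rightHalf]
  omega

lemma leftHalf_subset (I : DyadicInterval) : I.leftHalf.toSet ⊆ I.toSet := by
  rw [toSet_eq_union I]; exact Set.subset_union_left

lemma rightHalf_subset (I : DyadicInterval) : I.rightHalf.toSet ⊆ I.toSet := by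
  rw [toSet_eq_union I]; exact Set.subset_union_right

lemma measurableSet_toSet (I : DyadicInterval) : MeasurableSet I.toSet := measurableSet_Ico

lemma length_pos (I : DyadicInterval) : 0 < I.length := by unfold length; positivity

lemma length_leftHalf (I : DyadicInterval) : I.leftHalf.length = I.length / 2 := by
  simp only [length, leftHalf, neg_add, zpow_add₀ (two_ne_zero (α := ℝ))]
  norm_num; ring

lemma length_rightHalf (I : DyadicInterval) : I.rightHalf.length = I.length / 2 := by
  simp only [length, rightHalf, neg_add, zpow_add₀ (two_ne_zero (α := ℝ))]
  norm_num; ring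

lemma volume_toSet (I : DyadicInterval) : volume I.toSet = ENNReal.ofReal I.length := by
  unfold toSet length
  rw [Real.volume_Ico]; congr 1; ring

lemma toSet_nonempty (I : DyadicInterval) : I.toSet.Nonempty := by
  have h := length_pos I
  unfold length at h
  refine ⟨_, Set.left_mem_Ico.2 ?_⟩
  nlinarith

lemma lintegral_toSet (I : DyadicInterval) (f : ℝ → ℝ≥0∞) :
    ∫⁻ x in I.toSet, f x = (∫⁻ x in I.leftHalf.toSet, f x) + ∫⁻ x in I.rightHalf.toSet, f x := by
  rw [toSet_eq_union, lintegral_union (measurableSet_toSet _) (disjoint_halves I)]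

lemma iUnion_toSet (m : ℤ) : ⋃ k : ℤ, toSet (m, k) = Set.univ :=
  Set.eq_univ_of_forall fun x => Set.mem_iUnion.2 ⟨_, mem_toSet_index m x⟩

lemma pairwise_disjoint_toSet (m : ℤ) :
    Pairwise (Function.onFun Disjoint fun k : ℤ => toSet (m, k)) := by
  intro j k hjk
  rw [Function.onFun, Set.disjoint_left]
  intro x hx hy
  rw [mem_toSet_iff] at hx hy
  exact hjk (hx.symm.trans hy)

lemma lintegral_eq_tsum (m : ℤ) (f : ℝ → ℝ≥0∞) :
    ∫⁻ x, f x = ∑' k : ℤ, ∫⁻ x in toSet (m, k), f x := by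
  rw [← setLIntegral_univ, ← iUnion_toSet m,
    lintegral_iUnion (fun k => measurableSet_toSet _) (pairwise_disjoint_toSet m)]

lemma integrableOn_of_locallyIntegrable {E : Type*} [NormedAddCommGroup E] {f : ℝ → E}
    (hf : LocallyIntegrable f volume) (I : DyadicInterval) : IntegrableOn f I.toSet volume :=
  (hf.integrableOn_isCompact isCompact_Icc).mono_set Set.Ico_subset_Icc_self

end DyadicInterval

open DyadicInterval

lemma haar_eq_left {I : DyadicInterval} {x : ℝ} (hx : x ∈ I.leftHalf.toSet) :
    haar I x = -(Real.sqrt I.length)⁻¹ := by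
  have h := Set.disjoint_left.1 (disjoint_halves I) hx
  simp [haar, hx, h]

lemma haar_eq_right {I : DyadicInterval} {x : ℝ} (hx : x ∈ I.rightHalf.toSet) :
    haar I x = (Real.sqrt I.length)⁻¹ := by
  have h := Set.disjoint_right.1 (disjoint_halves I) hx
  simp [haar, hx, h]

lemma haar_eq_zero {I : DyadicInterval} {x : ℝ} (hx : x ∉ I.toSet) : haar I x = 0 := by
  have h1 : x ∉ I.leftHalf.toSet := fun h => hx (leftHalf_subset I h)
  have h2 : x ∉ I.rightHalf.toSet := fun h => hx (rightHalf_subset I h)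
  simp [haar, h1, h2]

lemma haar_eq_of_index_eq {I : DyadicInterval} {x y : ℝ}
    (h : index (I.1 + 1) x = index (I.1 + 1) y) : haar I x = haar I y := by
  simp only [haar, Set.indicator, mem_toSet_iff, leftHalf, rightHalf, h]

/-! ### Averages of matrix weights. -/

/-- The form `quad` is linear in the matrix, so it commutes with averaging. All averages of square
roots below enter through ‖A^{1/2} v‖² = `quad A v`. -/
lemma quad_avg {W : ℝ → Matrix (Fin n) (Fin n) ℂ} (hint : IsLocIntegrable W) (I : DyadicInterval)
    (v : Cn n) :
    IntegrableOn (fun x => quad (W x) v) I.toSet volume ∧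
      ∫ x in I.toSet, quad (W x) v = I.length * quad (avg W I) v := by
  have h1 : ∀ i j, IntegrableOn (fun x => (star (v i) * v j) * W x i j) I.toSet volume :=
    fun i j => (integrableOn_of_locallyIntegrable (hint i j) I).const_mul _
  have h2 : IntegrableOn (fun x => ∑ i, ∑ j, (star (v i) * v j) * W x i j) I.toSet volume :=
    integrable_finsetSum _ fun i _ => integrable_finsetSum _ fun j _ => h1 i j
  have hI := (length_pos I).ne'
  refine ⟨?_, ?_⟩
  · simp only [quad_eq_sum]
    exact h2.re
  · simp only [quad_eq_sum]
    have h3 := integral_re h2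
    simp only [RCLike.re_eq_complex_re] at h3
    rw [h3, integral_finsetSum _ fun i _ => integrable_finsetSum _ fun j _ => h1 i j]
    rw [← Complex.re_ofReal_mul]
    congr 1
    rw [Finset.mul_sum]
    refine Finset.sum_congr rfl fun i _ => ?_
    rw [integral_finsetSum _ fun j _ => h1 i j, Finset.mul_sum]
    refine Finset.sum_congr rfl fun j _ => ?_
    rw [integral_const_mul]
    simp only [avg, Matrix.of_apply, Complex.real_smul]
    push_cast
    have : (I.length : ℂ) ≠ 0 := by exact_mod_cast hI
    field_simp

lemma isHermitian_avg {W : ℝ → Matrix (Fin n) (Fin n) ℂ} (hW : IsMatrixWeight W)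
    (I : DyadicInterval) : (avg W I).IsHermitian := by
  ext i j
  simp only [avg, Matrix.conjTranspose_apply, Matrix.of_apply, Complex.real_smul, star_mul',
    RCLike.star_def, Complex.conj_ofReal]
  congr 1
  rw [← integral_conj]
  refine integral_congr_ae (ae_restrict_of_ae ?_)
  filter_upwards [hW.posDef] with x hx
  exact hx.isHermitian.apply i j

lemma lintegral_norm_act_sqrt_sq {W : ℝ → Matrix (Fin n) (Fin n) ℂ} (hW : IsMatrixWeight W)
    (hint : IsLocIntegrable W) (I : DyadicInterval) (v : Cn n) :
    ∫⁻ x in I.toSet, ENNReal.ofReal (‖act (CFC.sqrt (W x)) v‖ ^ 2) =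
      ENNReal.ofReal (I.length * quad (avg W I) v) := by
  obtain ⟨h1, h2⟩ := quad_avg hint I v
  rw [← h2, ofReal_integral_eq_lintegral_ofReal h1]
  · refine lintegral_congr_ae (ae_restrict_of_ae ?_)
    filter_upwards [hW.posDef] with x hx
    rw [norm_act_sqrt_sq hx.posSemidef]
  · refine ae_restrict_of_ae ?_
    filter_upwards [hW.posDef] with x hx
    exact quad_nonneg hx.posSemidef v

lemma posDef_avg {W : ℝ → Matrix (Fin n) (Fin n) ℂ} (hW : IsMatrixWeight W)
    (hint : IsLocIntegrable W) (I : DyadicInterval) : (avg W I).PosDef := by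
  refine Matrix.PosDef.of_dotProduct_mulVec_pos (isHermitian_avg hW I) fun v hv => ?_
  set w : Cn n := WithLp.toLp 2 v with hw
  have hw0 : w ≠ 0 := by simpa [hw] using hv
  have hp : 0 < quad (avg W I) w := by
    obtain ⟨h1, h2⟩ := quad_avg hint I w
    have h3 : 0 < ∫ x in I.toSet, quad (W x) w := by
      rw [integral_pos_iff_support_of_nonneg_ae _ h1]
      · have : (Function.support fun x => quad (W x) w) =ᵐ[volume.restrict I.toSet] Set.univ := by
          rw [Filter.eventuallyEq_univ]
          refine ae_restrict_of_ae ?_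
          filter_upwards [hW.posDef] with x hx
          exact (quad_pos hx hw0).ne'
        rw [measure_congr this, Measure.restrict_apply_univ, volume_toSet]
        exact ENNReal.ofReal_pos.2 (length_pos I)
      · refine ae_restrict_of_ae ?_
        filter_upwards [hW.posDef] with x hx
        exact quad_nonneg hx.posSemidef w
    rw [h2] at h3
    exact pos_of_mul_pos_right h3 (length_pos I).le
  rw [quad_eq_dotProduct] at hp
  rw [Complex.lt_def]
  refine ⟨hp, ?_⟩
  have := (isHermitian_avg hW I).im_star_dotProduct_mulVec_self v
  simpa using this.symm

/-- `|I| ‖⟨W⟩_I^{1/2} v‖² = ∫_I ‖W^{1/2} v‖²`. -/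
lemma lintegral_norm_act_sqrt_sq' {W : ℝ → Matrix (Fin n) (Fin n) ℂ} (hW : IsMatrixWeight W)
    (hint : IsLocIntegrable W) (I : DyadicInterval) (v : Cn n) :
    ∫⁻ x in I.toSet, ENNReal.ofReal (‖act (CFC.sqrt (W x)) v‖ ^ 2) =
      ENNReal.ofReal (I.length * ‖act (CFC.sqrt (avg W I)) v‖ ^ 2) := by
  rw [lintegral_norm_act_sqrt_sq hW hint, norm_act_sqrt_sq (posDef_avg hW hint I).posSemidef]

lemma norm_act_sqrt_avg_halves {W : ℝ → Matrix (Fin n) (Fin n) ℂ} (hW : IsMatrixWeight W)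
    (hint : IsLocIntegrable W) (I : DyadicInterval) (v : Cn n) :
    ‖act (CFC.sqrt (avg W I.leftHalf)) v‖ ^ 2 + ‖act (CFC.sqrt (avg W I.rightHalf)) v‖ ^ 2 =
      2 * ‖act (CFC.sqrt (avg W I)) v‖ ^ 2 := by
  have h := lintegral_norm_act_sqrt_sq' hW hint I v
  have hI := length_pos I
  rw [lintegral_toSet, lintegral_norm_act_sqrt_sq' hW hint, lintegral_norm_act_sqrt_sq' hW hint,
    length_leftHalf, length_rightHalf, ← ENNReal.ofReal_add (by positivity) (by positivity),
    ENNReal.ofReal_eq_ofReal_iff (by positivity) (by positivity)] at h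
  have h2 : I.length * (‖act (CFC.sqrt (avg W I.leftHalf)) v‖ ^ 2 +
      ‖act (CFC.sqrt (avg W I.rightHalf)) v‖ ^ 2) =
        I.length * (2 * ‖act (CFC.sqrt (avg W I)) v‖ ^ 2) := by linarith
  exact mul_left_cancel₀ hI.ne' h2

/-! ### The martingale that drives the stopping time. -/

/-- The Hilbert--Schmidt quantity
`‖⟨U⟩_I^{1/2} ⟨U⟩_T^{-1/2}‖² + ‖⟨W⟩_I^{1/2} ⟨U⟩_T^{1/2}‖²` that governs the stopping intervals. -/
def spread (U W : ℝ → Matrix (Fin n) (Fin n) ℂ) (T I : DyadicInterval) : ℝ :=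
  (∑ i, ‖act (CFC.sqrt (avg U I)) (act (CFC.sqrt (avg U T))⁻¹ (EuclideanSpace.single i 1))‖ ^ 2) +
    ∑ i, ‖act (CFC.sqrt (avg W I)) (act (CFC.sqrt (avg U T)) (EuclideanSpace.single i 1))‖ ^ 2

section Spread

variable {U W : ℝ → Matrix (Fin n) (Fin n) ℂ}

lemma spread_nonneg (T I : DyadicInterval) : 0 ≤ spread U W T I := by
  unfold spread; positivity

/-- For fixed T each summand is the quadratic form of an average over I at a fixed vector, hence a
martingale in I. This is why Hilbert--Schmidt norms replace operator norms, whose squares are only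
submartingales. -/
lemma spread_halves (hU : IsMatrixWeight U) (hW : IsMatrixWeight W) (hUint : IsLocIntegrable U)
    (hWint : IsLocIntegrable W) (T I : DyadicInterval) :
    spread U W T I.leftHalf + spread U W T I.rightHalf = 2 * spread U W T I := by
  unfold spread
  rw [add_add_add_comm, ← Finset.sum_add_distrib, ← Finset.sum_add_distrib, mul_add,
    Finset.mul_sum, Finset.mul_sum]
  simp only [norm_act_sqrt_avg_halves hU hUint, norm_act_sqrt_avg_halves hW hWint]

lemma norm_act_sqrt_avg_sq_le_spread (hU : IsMatrixWeight U) (hUint : IsLocIntegrable U)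
    (T I : DyadicInterval) (v : Cn n) :
    ‖act (CFC.sqrt (avg U I)) v‖ ^ 2 ≤ spread U W T I * ‖act (CFC.sqrt (avg U T)) v‖ ^ 2 := by
  have h := norm_act_sq_le (CFC.sqrt (avg U I) * (CFC.sqrt (avg U T))⁻¹)
    (act (CFC.sqrt (avg U T)) v)
  rw [act_mul, act_sqrt_inv_act_sqrt (posDef_avg hU hUint T)] at h
  refine h.trans ?_
  unfold spread
  simp only [act_mul]
  gcongr
  exact le_add_of_nonneg_right (by positivity)

/-- `spread` has the factors in the order that is linear in ⟨W⟩_I; the estimate of b_I needs the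
adjoint order, which has the same norm. -/
lemma norm_act_sqrt_avg_act_sq_le_spread (T I : DyadicInterval) (v : Cn n) :
    ‖act (CFC.sqrt (avg U T)) (act (CFC.sqrt (avg W I)) v)‖ ^ 2 ≤ spread U W T I * ‖v‖ ^ 2 := by
  refine norm_act_act_sq_le_swap (isHermitian_sqrt _) (isHermitian_sqrt _) v fun w => ?_
  have h := norm_act_sq_le (CFC.sqrt (avg W I) * CFC.sqrt (avg U T)) w
  rw [act_mul] at h
  refine h.trans ?_
  unfold spread
  simp only [act_mul]
  gcongr
  exact le_add_of_nonneg_left (by positivity)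

lemma exists_spread_self_le (hU : IsMatrixWeight U) (hUint : IsLocIntegrable U)
    (hA2 : DyadicJointA2 U W) : ∃ κ : ℝ, 0 < κ ∧ ∀ T, spread U W T T ≤ κ := by
  obtain ⟨C, hC⟩ := hA2
  -- At I = T the first sum equals n and each of the n terms of the second is at most |C|. The 1 and
  -- the absolute value matter for n = 0, where the hypothesis says nothing about C.
  refine ⟨n + n * |C| + 1, by positivity, fun T => ?_⟩
  have hUT := posDef_avg hU hUint T
  have h1 : ∀ v : Cn n,
      ‖act (CFC.sqrt (avg U T)) (act (CFC.sqrt (avg W T)) v)‖ ^ 2 ≤ |C| * ‖v‖ ^ 2 := by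
    intro v
    have h2 := quad_nonneg (hC T).posSemidef v
    have h3 : quad ((C : ℂ) • (1 : Matrix (Fin n) (Fin n) ℂ)
        - CFC.sqrt (avg W T) * avg U T * CFC.sqrt (avg W T)) v =
        C * ‖v‖ ^ 2 - quad (avg U T) (act (CFC.sqrt (avg W T)) v) := by
      have h4 : act ((C : ℂ) • (1 : Matrix (Fin n) (Fin n) ℂ)
          - CFC.sqrt (avg W T) * avg U T * CFC.sqrt (avg W T)) v =
          (C : ℂ) • v - act (CFC.sqrt (avg W T)) (act (avg U T) (act (CFC.sqrt (avg W T)) v)) := by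
        unfold act
        rw [map_sub, map_smul, map_one, map_mul, map_mul]
        rfl
      unfold quad
      rw [h4, inner_sub_right, ← inner_act_left (isHermitian_sqrt _), inner_smul_right,
        inner_self_eq_norm_sq_to_K, Complex.sub_re, Complex.re_ofReal_mul]
      norm_cast
    rw [h3, ← norm_act_sqrt_sq hUT.posSemidef] at h2
    have h5 : C * ‖v‖ ^ 2 ≤ |C| * ‖v‖ ^ 2 := by gcongr; exact le_abs_self C
    linarith
  have h2 : ∀ v : Cn n,
      ‖act (CFC.sqrt (avg W T)) (act (CFC.sqrt (avg U T)) v)‖ ^ 2 ≤ |C| * ‖v‖ ^ 2 := fun v =>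
    norm_act_act_sq_le_swap (isHermitian_sqrt _) (isHermitian_sqrt _) v h1
  have h3 : ∑ i : Fin n, ‖act (CFC.sqrt (avg W T)) (act (CFC.sqrt (avg U T))
      (EuclideanSpace.single i 1))‖ ^ 2 ≤ ∑ _i : Fin n, |C| :=
    Finset.sum_le_sum fun i _ => (h2 _).trans (by simp)
  have h4 : ∑ i : Fin n, ‖act (CFC.sqrt (avg U T)) (act (CFC.sqrt (avg U T))⁻¹
      (EuclideanSpace.single i 1))‖ ^ 2 = n := by
    simp [act_sqrt_act_sqrt_inv hUT]
  unfold spread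
  rw [h4]
  simp only [Finset.sum_const, Finset.card_univ, Fintype.card_fin, nsmul_eq_mul] at h3
  linarith

end Spread

/-! ### Counting stopping intervals. -/

/-- The weight `(3/2)^s`, where `s` counts the stopping intervals `J ∋ x` of generation at most `e`
below `I`, when `T` is the last stopping interval before. An interval `J` is stopping after `T` if
`2 κ < σ T J`. -/
def stoppingWeight (σ : DyadicInterval → DyadicInterval → ℝ) (κ : ℝ) :
    ℕ → DyadicInterval → DyadicInterval → ℝ → ℝ
  | 0, _, _ => fun _ => 1
  | e + 1, T, I =>
    I.leftHalf.toSet.indicator (fun x =>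
      if 2 * κ < σ T I.leftHalf then (3 / 2) * stoppingWeight σ κ e I.leftHalf I.leftHalf x
      else stoppingWeight σ κ e T I.leftHalf x) +
    I.rightHalf.toSet.indicator (fun x =>
      if 2 * κ < σ T I.rightHalf then (3 / 2) * stoppingWeight σ κ e I.rightHalf I.rightHalf x
      else stoppingWeight σ κ e T I.rightHalf x)

section StoppingWeight

variable {σ : DyadicInterval → DyadicInterval → ℝ} {κ : ℝ}

lemma stoppingWeight_succ_left (e : ℕ) (T I : DyadicInterval) {x : ℝ}
    (hx : x ∈ I.leftHalf.toSet) :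
    stoppingWeight σ κ (e + 1) T I x =
      if 2 * κ < σ T I.leftHalf then (3 / 2) * stoppingWeight σ κ e I.leftHalf I.leftHalf x
      else stoppingWeight σ κ e T I.leftHalf x := by
  have h := Set.disjoint_left.1 (disjoint_halves I) hx
  simp [stoppingWeight, hx, h]

lemma stoppingWeight_succ_right (e : ℕ) (T I : DyadicInterval) {x : ℝ}
    (hx : x ∈ I.rightHalf.toSet) :
    stoppingWeight σ κ (e + 1) T I x =
      if 2 * κ < σ T I.rightHalf then (3 / 2) * stoppingWeight σ κ e I.rightHalf I.rightHalf x
      else stoppingWeight σ κ e T I.rightHalf x := by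
  have h := Set.disjoint_right.1 (disjoint_halves I) hx
  simp [stoppingWeight, hx, h]

lemma stoppingWeight_nonneg (e : ℕ) (T I : DyadicInterval) (x : ℝ) :
    0 ≤ stoppingWeight σ κ e T I x := by
  induction e generalizing T I x with
  | zero => simp [stoppingWeight]
  | succ e ih =>
    simp only [stoppingWeight, Pi.add_apply]
    refine add_nonneg (Set.indicator_nonneg (fun y _ => ?_) x)
      (Set.indicator_nonneg (fun y _ => ?_) x) <;>
    · split_ifs
      · exact mul_nonneg (by norm_num) (ih _ _ _)
      · exact ih _ _ _

lemma measurable_stoppingWeight (e : ℕ) (T I : DyadicInterval) :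
    Measurable (stoppingWeight σ κ e T I) := by
  induction e generalizing T I with
  | zero => exact measurable_const
  | succ e ih =>
    simp only [stoppingWeight]
    refine Measurable.add (Measurable.indicator ?_ (measurableSet_toSet _))
      (Measurable.indicator ?_ (measurableSet_toSet _)) <;>
    · split_ifs
      · exact (ih _ _).const_mul _
      · exact ih _ _

/-- The bound 1 + 3σ/κ is itself a martingale, so it passes from the halves to I without loss; only
a stop needs an argument, and there the large value of σ pays for the restart. -/
lemma lintegral_stoppingWeight_le (hκ : 0 < κ) (h0 : ∀ T I, 0 ≤ σ T I)
    (hself : ∀ T, σ T T ≤ κ)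
    (hhalves : ∀ T I, σ T (leftHalf I) + σ T (rightHalf I) = 2 * σ T I)
    (e : ℕ) (T I : DyadicInterval) :
    ∫⁻ x in I.toSet, ENNReal.ofReal (stoppingWeight σ κ e T I x) ≤
      ENNReal.ofReal (I.length * (1 + 3 * σ T I / κ)) := by
  induction e generalizing T I with
  | zero =>
    have := h0 T I
    simp only [stoppingWeight, ENNReal.ofReal_one, setLIntegral_const, one_mul, volume_toSet]
    refine ENNReal.ofReal_le_ofReal (le_mul_of_one_le_right (length_pos I).le ?_)
    have : 0 ≤ 3 * σ T I / κ := by positivity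
    linarith
  | succ e ih =>
    have child : ∀ J, ∫⁻ x in J.toSet, ENNReal.ofReal
        (if 2 * κ < σ T J then (3 / 2) * stoppingWeight σ κ e J J x
          else stoppingWeight σ κ e T J x) ≤ ENNReal.ofReal (J.length * (1 + 3 * σ T J / κ)) := by
      intro J
      have hJ := length_pos J
      split_ifs with h
      · have h1 : ∀ x, ENNReal.ofReal ((3 / 2) * stoppingWeight σ κ e J J x) =
            ENNReal.ofReal (3 / 2) * ENNReal.ofReal (stoppingWeight σ κ e J J x) := fun x =>
          ENNReal.ofReal_mul (by norm_num)
        simp only [h1]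
        rw [lintegral_const_mul _ (measurable_stoppingWeight e J J).ennreal_ofReal]
        refine (mul_le_mul_right (ih J J) _).trans ?_
        rw [← ENNReal.ofReal_mul (by norm_num)]
        refine ENNReal.ofReal_le_ofReal ?_
        -- A restart costs (3/2)(1 + 3) = 6, and a stop means 3σ(T, J)/κ > 6: this fixes the
        -- constants 3/2, 2κ and 3.
        have h2 : 3 * σ J J / κ ≤ 3 := by
          rw [div_le_iff₀ hκ]; linarith [hself J]
        have h3 : 6 ≤ 3 * σ T J / κ := by
          rw [le_div_iff₀ hκ]; linarith
        nlinarith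
      · exact ih T J
    rw [lintegral_toSet, setLIntegral_congr_fun (measurableSet_toSet _)
      (fun x hx => by rw [stoppingWeight_succ_left e T I hx]),
      setLIntegral_congr_fun (measurableSet_toSet I.rightHalf)
      (fun x hx => by rw [stoppingWeight_succ_right e T I hx])]
    refine (add_le_add (child _) (child _)).trans ?_
    have hl := h0 T I.leftHalf
    have hr := h0 T I.rightHalf
    have hI := length_pos I
    have hIl := length_pos I.leftHalf
    have hIr := length_pos I.rightHalf
    rw [← ENNReal.ofReal_add (by positivity) (by positivity), length_leftHalf, length_rightHalf]
    refine ENNReal.ofReal_le_ofReal (le_of_eq ?_)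
    have := hhalves T I
    field_simp
    linear_combination 3 * this

end StoppingWeight

/-! ### Weighted estimates from the reverse Hölder inequality. -/

lemma norm_add_sq_le_weighted {E : Type*} [SeminormedAddCommGroup E] {ε : ℝ} (hε : 0 < ε)
    (a b : E) : ‖a + b‖ ^ 2 ≤ (1 + ε) * ‖a‖ ^ 2 + (1 + ε⁻¹) * ‖b‖ ^ 2 := by
  have h1 : ‖a + b‖ ^ 2 ≤ (‖a‖ + ‖b‖) ^ 2 := by gcongr; exact norm_add_le a b
  have h2 : ε * ‖a‖ ^ 2 + ε⁻¹ * ‖b‖ ^ 2 - 2 * ‖a‖ * ‖b‖ = ε⁻¹ * (ε * ‖a‖ - ‖b‖) ^ 2 := by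
    field_simp; ring
  have h3 : 0 ≤ ε⁻¹ * (ε * ‖a‖ - ‖b‖) ^ 2 := by positivity
  nlinarith

lemma two_mul_ofReal (p : ℝ) : 2 * ENNReal.ofReal p = ENNReal.ofReal (2 * p) := by
  rw [ENNReal.ofReal_mul zero_le_two, ENNReal.ofReal_ofNat]

/-- Young's inequality in the form `w^(1 - 2/r) s² ≤ P² w + P^(2 - r) s^r`. -/
lemma rpow_mul_sq_le {r w s P : ℝ} (hr : 2 < r) (hw : 0 ≤ w) (hs : 0 ≤ s) (hP : 0 < P) :
    w ^ (1 - 2 / r) * s ^ 2 ≤ P ^ 2 * w + P ^ 2 / P ^ r * s ^ r := by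
  have hr0 : 0 < r := by linarith
  have hr1 : 2 / r ≤ 1 := by rw [div_le_one hr0]; exact hr.le
  -- Weighted AM-GM for w and (s/P)^r with exponents 1 - 2/r and 2/r; P² is restored at the end.
  have h := Real.geom_mean_le_arith_mean2_weighted (w₁ := 1 - 2 / r) (w₂ := 2 / r)
    (p₁ := w) (p₂ := (s / P) ^ r) (by linarith) (by positivity) hw (by positivity) (by ring)
  rw [← Real.rpow_mul (by positivity), mul_div_cancel₀ _ hr0.ne', Real.rpow_two,
    Real.div_rpow hs hP.le] at h
  have h2 : (1 - 2 / r) * w + 2 / r * (s ^ r / P ^ r) ≤ w + s ^ r / P ^ r := by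
    have h3 : 0 ≤ 2 / r * w := by positivity
    have h4 : 2 / r * (s ^ r / P ^ r) ≤ 1 * (s ^ r / P ^ r) := by gcongr
    linarith
  have h5 := mul_le_mul_of_nonneg_left (h.trans h2) (sq_nonneg P)
  calc w ^ (1 - 2 / r) * s ^ 2 = P ^ 2 * (w ^ (1 - 2 / r) * (s / P) ^ 2) := by
        field_simp
    _ ≤ _ := h5
    _ = _ := by ring

/-- The reverse Hölder inequality, tested on vectors `⟨U⟩_I^{1/2} v`. -/
lemma reverseHolder_lintegral_le {U : ℝ → Matrix (Fin n) (Fin n) ℂ} (hU : IsMatrixWeight U)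
    (hUint : IsLocIntegrable U) {C r : ℝ}
    (hRH : ∀ (I : DyadicInterval) (y : Cn n), y ≠ 0 →
      ∫⁻ x in I.toSet, ENNReal.ofReal (‖act (CFC.sqrt (U x) * (CFC.sqrt (avg U I))⁻¹) y‖ ^ r)
        ≤ ENNReal.ofReal (C * I.length * ‖y‖ ^ r)) (I : DyadicInterval) {v : Cn n}
    (hv : act (CFC.sqrt (avg U I)) v ≠ 0) :
    ∫⁻ x in I.toSet, ENNReal.ofReal (‖act (CFC.sqrt (U x)) v‖ ^ r) ≤
      ENNReal.ofReal (C * I.length * ‖act (CFC.sqrt (avg U I)) v‖ ^ r) := by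
  have h := hRH I _ hv
  simpa only [act_mul, act_sqrt_inv_act_sqrt (posDef_avg hU hUint I)] using h

/-- Young's inequality at the scale P = ‖⟨U⟩_I^{1/2} v‖ makes both terms homogeneous: the mean of w
contributes b and the reverse Hölder bound contributes C. -/
lemma lintegral_rpow_mul_norm_act_sq_le {U : ℝ → Matrix (Fin n) (Fin n) ℂ}
    (hU : IsMatrixWeight U) (hUint : IsLocIntegrable U) {C r : ℝ} (hC : 0 < C) (hr : 2 < r)
    (hRH : ∀ (I : DyadicInterval) (y : Cn n), y ≠ 0 →
      ∫⁻ x in I.toSet, ENNReal.ofReal (‖act (CFC.sqrt (U x) * (CFC.sqrt (avg U I))⁻¹) y‖ ^ r)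
        ≤ ENNReal.ofReal (C * I.length * ‖y‖ ^ r)) (I : DyadicInterval) {w : ℝ → ℝ}
    (hwm : Measurable w) (hw0 : ∀ x, 0 ≤ w x) {b : ℝ} (hb : 0 ≤ b)
    (hw : ∫⁻ x in I.toSet, ENNReal.ofReal (w x) ≤ ENNReal.ofReal (b * I.length)) (v : Cn n) :
    ∫⁻ x in I.toSet, ENNReal.ofReal (w x ^ (1 - 2 / r) * ‖act (CFC.sqrt (U x)) v‖ ^ 2) ≤
      ENNReal.ofReal ((b + C) * (I.length * ‖act (CFC.sqrt (avg U I)) v‖ ^ 2)) := by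
  have hI := length_pos I
  -- The scale P must be nonzero; it vanishes only for v = 0, since ⟨U⟩_I is invertible.
  by_cases hv : act (CFC.sqrt (avg U I)) v = 0
  · have hv0 : v = 0 := by
      rw [← act_sqrt_inv_act_sqrt (posDef_avg hU hUint I) v, hv, act_zero]
    simp [hv0, act_zero]
  set P := ‖act (CFC.sqrt (avg U I)) v‖ with hP
  have hP0 : 0 < P := norm_pos_iff.2 hv
  have hRHI := reverseHolder_lintegral_le hU hUint hRH I hv
  calc ∫⁻ x in I.toSet, ENNReal.ofReal (w x ^ (1 - 2 / r) * ‖act (CFC.sqrt (U x)) v‖ ^ 2)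
      ≤ ∫⁻ x in I.toSet, (ENNReal.ofReal (P ^ 2) * ENNReal.ofReal (w x) +
          ENNReal.ofReal (P ^ 2 / P ^ r) * ENNReal.ofReal (‖act (CFC.sqrt (U x)) v‖ ^ r)) := by
        refine lintegral_mono fun x => ?_
        rw [← ENNReal.ofReal_mul (by positivity), ← ENNReal.ofReal_mul (by positivity),
          ← ENNReal.ofReal_add (mul_nonneg (by positivity) (hw0 x)) (by positivity)]
        exact ENNReal.ofReal_le_ofReal (rpow_mul_sq_le hr (hw0 x) (norm_nonneg _) hP0)
    _ = ENNReal.ofReal (P ^ 2) * (∫⁻ x in I.toSet, ENNReal.ofReal (w x)) +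
          ENNReal.ofReal (P ^ 2 / P ^ r) *
            ∫⁻ x in I.toSet, ENNReal.ofReal (‖act (CFC.sqrt (U x)) v‖ ^ r) := by
        rw [lintegral_add_left (hwm.ennreal_ofReal.const_mul _),
          lintegral_const_mul _ hwm.ennreal_ofReal, lintegral_const_mul' _ _ ENNReal.ofReal_ne_top]
    _ ≤ ENNReal.ofReal (P ^ 2) * ENNReal.ofReal (b * I.length) +
          ENNReal.ofReal (P ^ 2 / P ^ r) * ENNReal.ofReal (C * I.length * P ^ r) := by
        gcongr
    _ = _ := by
        rw [← ENNReal.ofReal_mul (by positivity), ← ENNReal.ofReal_mul (by positivity),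
          ← ENNReal.ofReal_add (by positivity) (by positivity)]
        congr 1
        field_simp

/-! ### Induction along the stopping trees. -/

/-- The Haar sum `∑ h_J b_J` over the descendants `J` of `I` of generation less than `e`. -/
def localHaarSum (b : DyadicInterval → Cn n) : ℕ → DyadicInterval → ℝ → Cn n
  | 0, _ => fun _ => 0
  | e + 1, I => fun x => haar I x • b I + (I.leftHalf.toSet.indicator (localHaarSum b e I.leftHalf) x
      + I.rightHalf.toSet.indicator (localHaarSum b e I.rightHalf) x)

lemma localHaarSum_succ_left (b : DyadicInterval → Cn n) (e : ℕ) (I : DyadicInterval) {x : ℝ}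
    (hx : x ∈ I.leftHalf.toSet) : localHaarSum b (e + 1) I x =
      -((Real.sqrt I.length)⁻¹ • b I) + localHaarSum b e I.leftHalf x := by
  have h := Set.disjoint_left.1 (disjoint_halves I) hx
  simp [localHaarSum, hx, h, haar_eq_left hx]

lemma localHaarSum_succ_right (b : DyadicInterval → Cn n) (e : ℕ) (I : DyadicInterval) {x : ℝ}
    (hx : x ∈ I.rightHalf.toSet) : localHaarSum b (e + 1) I x =
      (Real.sqrt I.length)⁻¹ • b I + localHaarSum b e I.rightHalf x := by
  have h := Set.disjoint_right.1 (disjoint_halves I) hx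
  simp [localHaarSum, hx, h, haar_eq_right hx]

/-- The stopping time estimate. The vector `z` is the sum of the contributions of the stopping
trees above the one with top `T`, and `c` the contribution of the tree of `T` above `I`. -/
lemma lintegral_norm_act_localHaarSum_sq_le {U : ℝ → Matrix (Fin n) (Fin n) ℂ}
    (hU : IsMatrixWeight U) (hUint : IsLocIntegrable U)
    {σ : DyadicInterval → DyadicInterval → ℝ} {κ θ ε K₀ : ℝ} (hκ : 0 < κ)
    (hself : ∀ T, σ T T ≤ κ)
    (hσU : ∀ T I v,
      ‖act (CFC.sqrt (avg U I)) v‖ ^ 2 ≤ σ T I * ‖act (CFC.sqrt (avg U T)) v‖ ^ 2)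
    {b : DyadicInterval → Cn n} {α : DyadicInterval → ℝ} (hα : ∀ I, 0 ≤ α I)
    (hσb : ∀ T I, ‖act (CFC.sqrt (avg U T)) (b I)‖ ^ 2 ≤ σ T I * α I)
    {E : DyadicInterval → ℝ≥0∞}
    (hE : ∀ I, ENNReal.ofReal (α I) + E I.leftHalf + E I.rightHalf ≤ E I)
    (hε : 0 < ε) (hθ : ((3 : ℝ) / 2) ^ θ = 1 + ε) (hK₀ : 0 ≤ K₀)
    (hweight : ∀ (e : ℕ) (I : DyadicInterval) (v : Cn n),
      ∫⁻ x in I.toSet, ENNReal.ofReal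
        (stoppingWeight σ κ e I I x ^ θ * ‖act (CFC.sqrt (U x)) v‖ ^ 2) ≤
          ENNReal.ofReal (K₀ * (I.length * ‖act (CFC.sqrt (avg U I)) v‖ ^ 2)))
    (e : ℕ) (T I : DyadicInterval) (hTI : σ T I ≤ 2 * κ) (z c : Cn n) :
    ∫⁻ x in I.toSet, ENNReal.ofReal (‖act (CFC.sqrt (U x)) (z + c + localHaarSum b e I x)‖ ^ 2) ≤
      2 * (∫⁻ x in I.toSet, ENNReal.ofReal
        (stoppingWeight σ κ e T I x ^ θ * ‖act (CFC.sqrt (U x)) z‖ ^ 2)) +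
      ENNReal.ofReal (4 * κ * (1 + 2 * (1 + ε⁻¹) * K₀)) *
        (ENNReal.ofReal (I.length * ‖act (CFC.sqrt (avg U T)) c‖ ^ 2) +
          ENNReal.ofReal (2 * κ) * E I) := by
  set K := 4 * κ * (1 + 2 * (1 + ε⁻¹) * K₀) with hK
  have hK0 : 0 ≤ K := by positivity
  have hAm : ∀ v : Cn n, AEMeasurable (fun x => ‖act (CFC.sqrt (U x)) v‖ ^ 2) volume := fun v =>
    (aemeasurable_act_sqrt hU aemeasurable_const).norm.pow_const 2
  induction e generalizing T I z c with
  | zero =>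
    have hI := length_pos I
    calc ∫⁻ x in I.toSet, ENNReal.ofReal (‖act (CFC.sqrt (U x)) (z + c + localHaarSum b 0 I x)‖ ^ 2)
        ≤ ∫⁻ x in I.toSet, (2 * ENNReal.ofReal (‖act (CFC.sqrt (U x)) z‖ ^ 2) +
            2 * ENNReal.ofReal (‖act (CFC.sqrt (U x)) c‖ ^ 2)) := by
          refine lintegral_mono fun x => ?_
          have h := norm_add_sq_le_weighted one_pos (act (CFC.sqrt (U x)) z)
            (act (CFC.sqrt (U x)) c)
          norm_num at h
          rw [two_mul_ofReal, two_mul_ofReal, ← ENNReal.ofReal_add (by positivity) (by positivity)]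
          simp only [localHaarSum, add_zero, act_add]
          exact ENNReal.ofReal_le_ofReal h
      _ = 2 * (∫⁻ x in I.toSet, ENNReal.ofReal (‖act (CFC.sqrt (U x)) z‖ ^ 2)) +
            2 * ENNReal.ofReal (I.length * ‖act (CFC.sqrt (avg U I)) c‖ ^ 2) := by
          rw [lintegral_add_left' ((hAm z).restrict.ennreal_ofReal.const_mul _),
            lintegral_const_mul' _ _ (by simp), lintegral_const_mul' _ _ (by simp),
            lintegral_norm_act_sqrt_sq' hU hUint I c]
      _ ≤ _ := by
          simp only [stoppingWeight, Real.one_rpow, one_mul]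
          refine add_le_add le_rfl ?_
          refine le_trans ?_ (mul_le_mul_right le_self_add _)
          rw [two_mul_ofReal, ← ENNReal.ofReal_mul hK0]
          refine ENNReal.ofReal_le_ofReal ?_
          have h1 : ‖act (CFC.sqrt (avg U I)) c‖ ^ 2 ≤ 2 * κ * ‖act (CFC.sqrt (avg U T)) c‖ ^ 2 :=
            (hσU T I c).trans (by gcongr)
          -- At a leaf, 4κ is the factor 2 from ‖z + c‖² times the 2κ comparing ⟨U⟩_I with ⟨U⟩_T.
          have h2 : 4 * κ ≤ K := by
            rw [hK]
            refine le_mul_of_one_le_right (by positivity) ?_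
            have : 0 ≤ 2 * (1 + ε⁻¹) * K₀ := by positivity
            linarith
          calc 2 * (I.length * ‖act (CFC.sqrt (avg U I)) c‖ ^ 2)
              ≤ 2 * (I.length * (2 * κ * ‖act (CFC.sqrt (avg U T)) c‖ ^ 2)) := by gcongr
            _ = 4 * κ * (I.length * ‖act (CFC.sqrt (avg U T)) c‖ ^ 2) := by ring
            _ ≤ _ := by gcongr
  | succ e ih =>
    have hI := length_pos I
    have child : ∀ J : DyadicInterval, J.length = I.length / 2 →
        (∀ v, ‖act (CFC.sqrt (avg U J)) v‖ ^ 2 ≤ 2 * ‖act (CFC.sqrt (avg U I)) v‖ ^ 2) →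
        ∀ c' : Cn n, ∫⁻ x in J.toSet,
          ENNReal.ofReal (‖act (CFC.sqrt (U x)) (z + c' + localHaarSum b e J x)‖ ^ 2) ≤
          2 * (∫⁻ x in J.toSet, ENNReal.ofReal
            ((if 2 * κ < σ T J then (3 / 2) * stoppingWeight σ κ e J J x
              else stoppingWeight σ κ e T J x) ^ θ * ‖act (CFC.sqrt (U x)) z‖ ^ 2)) +
          ENNReal.ofReal K * (ENNReal.ofReal (J.length * ‖act (CFC.sqrt (avg U T)) c'‖ ^ 2) +
            ENNReal.ofReal (2 * κ) * E J) := by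
      intro J hJI hJU c'
      have hJ := length_pos J
      split_ifs with hbad
      -- J stops: the tree of T is finished above J, so c' joins z and the new tree with top J
      -- starts with contribution 0.
      · have hJJ : σ J J ≤ 2 * κ := by linarith [hself J]
        have h1 := ih J J hJJ (z + c') 0
        rw [add_zero, act_zero, norm_zero] at h1
        refine h1.trans ?_
        have h2 : ∫⁻ x in J.toSet, ENNReal.ofReal
            (stoppingWeight σ κ e J J x ^ θ * ‖act (CFC.sqrt (U x)) (z + c')‖ ^ 2) ≤
            (∫⁻ x in J.toSet, ENNReal.ofReal (((3 / 2) * stoppingWeight σ κ e J J x) ^ θ *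
              ‖act (CFC.sqrt (U x)) z‖ ^ 2)) +
            ENNReal.ofReal (1 + ε⁻¹) * ∫⁻ x in J.toSet, ENNReal.ofReal
              (stoppingWeight σ κ e J J x ^ θ * ‖act (CFC.sqrt (U x)) c'‖ ^ 2) := by
          rw [← lintegral_const_mul' _ _ ENNReal.ofReal_ne_top, ← lintegral_add_left']
          · refine lintegral_mono fun x => ?_
            have hw := stoppingWeight_nonneg (σ := σ) (κ := κ) e J J x
            have hwθ : 0 ≤ stoppingWeight σ κ e J J x ^ θ := Real.rpow_nonneg hw _
            -- The factor 3/2 gained by stopping, raised to θ, is exactly the 1 + ε lost in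
            -- splitting z + c'.
            rw [Real.mul_rpow (by norm_num) hw, hθ, ← ENNReal.ofReal_mul (by positivity),
              ← ENNReal.ofReal_add (by positivity) (by positivity), act_add]
            refine ENNReal.ofReal_le_ofReal ?_
            have h := mul_le_mul_of_nonneg_left (norm_add_sq_le_weighted hε
              (act (CFC.sqrt (U x)) z) (act (CFC.sqrt (U x)) c')) hwθ
            linarith
          · exact (((((measurable_stoppingWeight e J J).const_mul _).pow_const
              θ).aemeasurable.mul (hAm z)).ennreal_ofReal).restrict
        have h3 : K₀ * (J.length * ‖act (CFC.sqrt (avg U J)) c'‖ ^ 2) ≤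
            K₀ * (4 * κ * (J.length * ‖act (CFC.sqrt (avg U T)) c'‖ ^ 2)) := by
          -- σ(T, J) has no upper bound from the stopping rule, but the parent I satisfies σ(T, I) ≤
          -- 2κ, and passing to a half at most doubles an average.
          have h5 : ‖act (CFC.sqrt (avg U I)) c'‖ ^ 2 ≤
            2 * κ * ‖act (CFC.sqrt (avg U T)) c'‖ ^ 2 := (hσU T I c').trans (by gcongr)
          have h6 := hJU c'
          have h4 : ‖act (CFC.sqrt (avg U J)) c'‖ ^ 2 ≤
            4 * κ * ‖act (CFC.sqrt (avg U T)) c'‖ ^ 2 := by linarith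
          calc K₀ * (J.length * ‖act (CFC.sqrt (avg U J)) c'‖ ^ 2)
              ≤ K₀ * (J.length * (4 * κ * ‖act (CFC.sqrt (avg U T)) c'‖ ^ 2)) := by gcongr
            _ = _ := by ring
        have h4 := (hweight e J c').trans (ENNReal.ofReal_le_ofReal h3)
        have h5 : 2 * (ENNReal.ofReal (1 + ε⁻¹) * ENNReal.ofReal
            (K₀ * (4 * κ * (J.length * ‖act (CFC.sqrt (avg U T)) c'‖ ^ 2)))) ≤
            ENNReal.ofReal K * ENNReal.ofReal (J.length * ‖act (CFC.sqrt (avg U T)) c'‖ ^ 2) := by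
          rw [← ENNReal.ofReal_mul (by positivity), two_mul_ofReal, ← ENNReal.ofReal_mul hK0]
          refine ENNReal.ofReal_le_ofReal ?_
          rw [hK]
          have : 0 ≤ 4 * κ * (J.length * ‖act (CFC.sqrt (avg U T)) c'‖ ^ 2) := by positivity
          linarith
        calc 2 * (∫⁻ x in J.toSet, ENNReal.ofReal
              (stoppingWeight σ κ e J J x ^ θ * ‖act (CFC.sqrt (U x)) (z + c')‖ ^ 2)) +
              ENNReal.ofReal K * (ENNReal.ofReal (J.length * 0 ^ 2) + ENNReal.ofReal (2 * κ) * E J)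
            ≤ 2 * ((∫⁻ x in J.toSet, ENNReal.ofReal (((3 / 2) * stoppingWeight σ κ e J J x) ^ θ *
              ‖act (CFC.sqrt (U x)) z‖ ^ 2)) + ENNReal.ofReal (1 + ε⁻¹) * ENNReal.ofReal
            (K₀ * (4 * κ * (J.length * ‖act (CFC.sqrt (avg U T)) c'‖ ^ 2)))) +
              ENNReal.ofReal K * (ENNReal.ofReal (2 * κ) * E J) := by
              refine add_le_add (mul_le_mul_right (h2.trans ?_) _) (by simp)
              exact add_le_add le_rfl (mul_le_mul_right h4 _)
          _ ≤ _ := by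
              rw [mul_add, mul_add (ENNReal.ofReal K), add_assoc]
              exact add_le_add le_rfl (add_le_add h5 le_rfl)
      · exact ih T J (not_lt.1 hbad) z c'
    set t := (Real.sqrt I.length)⁻¹ with ht
    have ht2 : I.length * t ^ 2 = 1 := by
      rw [ht, inv_pow, Real.sq_sqrt hI.le, mul_inv_cancel₀ hI.ne']
    have hhalf := norm_act_sqrt_avg_halves hU hUint I
    have hl := child I.leftHalf (length_leftHalf I)
      (fun v => by rw [← hhalf v]; exact le_add_of_nonneg_right (sq_nonneg _)) (c + -(t • b I))
    have hr := child I.rightHalf (length_rightHalf I)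
      (fun v => by rw [← hhalf v]; exact le_add_of_nonneg_left (sq_nonneg _)) (c + t • b I)
    have hwl : ∫⁻ x in I.leftHalf.toSet, ENNReal.ofReal
        (stoppingWeight σ κ (e + 1) T I x ^ θ * ‖act (CFC.sqrt (U x)) z‖ ^ 2) = _ :=
      setLIntegral_congr_fun (measurableSet_toSet I.leftHalf) (fun x hx => by
        rw [stoppingWeight_succ_left e T I hx])
    have hwr : ∫⁻ x in I.rightHalf.toSet, ENNReal.ofReal
        (stoppingWeight σ κ (e + 1) T I x ^ θ * ‖act (CFC.sqrt (U x)) z‖ ^ 2) = _ :=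
      setLIntegral_congr_fun (measurableSet_toSet I.rightHalf) (fun x hx => by
        rw [stoppingWeight_succ_right e T I hx])
    rw [lintegral_toSet, lintegral_toSet I (fun x => ENNReal.ofReal
        (stoppingWeight σ κ (e + 1) T I x ^ θ * ‖act (CFC.sqrt (U x)) z‖ ^ 2)),
      setLIntegral_congr_fun (measurableSet_toSet I.leftHalf) (fun x hx => by
        rw [localHaarSum_succ_left b e I hx, ← add_assoc, add_assoc z]),
      setLIntegral_congr_fun (measurableSet_toSet I.rightHalf) (fun x hx => by
        rw [localHaarSum_succ_right b e I hx, ← add_assoc, add_assoc z]),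
      hwl, hwr]
    refine (add_le_add hl hr).trans ?_
    -- The halves carry c - t b_I and c + t b_I, so the cross terms cancel. Since |I| t² = 1, the
    -- increment is ‖⟨U⟩_T^{1/2} b_I‖² ≤ 2κ α_I, charged to the energy E.
    have hpar : I.leftHalf.length * ‖act (CFC.sqrt (avg U T)) (c + -(t • b I))‖ ^ 2 +
        I.rightHalf.length * ‖act (CFC.sqrt (avg U T)) (c + t • b I)‖ ^ 2 ≤
        I.length * ‖act (CFC.sqrt (avg U T)) c‖ ^ 2 + 2 * κ * α I := by
      have h1 : ‖act (CFC.sqrt (avg U T)) (b I)‖ ^ 2 ≤ 2 * κ * α I :=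
        (hσb T I).trans (mul_le_mul_of_nonneg_right hTI (hα I))
      have h2 := parallelogram_law_with_norm ℝ (act (CFC.sqrt (avg U T)) c)
        (t • act (CFC.sqrt (avg U T)) (b I))
      rw [norm_smul, Real.norm_eq_abs] at h2
      rw [← sub_eq_add_neg, length_leftHalf, length_rightHalf, act_add, sub_eq_add_neg, act_add,
        ← neg_one_smul ℝ (t • b I), act_smul_real, act_smul_real, neg_one_smul, ← sub_eq_add_neg]
      have h3 : |t| * |t| = t ^ 2 := by rw [abs_mul_abs_self, sq]
      have h4 : I.length / 2 * ‖act (CFC.sqrt (avg U T)) c - t • act (CFC.sqrt (avg U T)) (b I)‖ ^ 2 +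
        I.length / 2 * ‖act (CFC.sqrt (avg U T)) c + t • act (CFC.sqrt (avg U T)) (b I)‖ ^ 2 =
        I.length * ‖act (CFC.sqrt (avg U T)) c‖ ^ 2 +
          (I.length * t ^ 2) * ‖act (CFC.sqrt (avg U T)) (b I)‖ ^ 2 := by
        rw [← h3]
        linear_combination (I.length / 2) * h2
      rw [h4, ht2]
      linarith
    have hlen := length_pos I.leftHalf
    have hlen' := length_pos I.rightHalf
    have hsum := ENNReal.ofReal_le_ofReal hpar
    rw [ENNReal.ofReal_add (by positivity) (by positivity), ENNReal.ofReal_add (by positivity)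
      (mul_nonneg (by positivity) (hα I)), ENNReal.ofReal_mul (p := 2 * κ) (by positivity)] at hsum
    have hEI := mul_le_mul_right (hE I) (ENNReal.ofReal (2 * κ))
    rw [mul_add, mul_add] at hEI
    calc _ = 2 * ((∫⁻ x in I.leftHalf.toSet, _) + ∫⁻ x in I.rightHalf.toSet, _) +
          ENNReal.ofReal K *
          ((ENNReal.ofReal (I.leftHalf.length *
            ‖act (CFC.sqrt (avg U T)) (c + -(t • b I))‖ ^ 2) +
          ENNReal.ofReal (I.rightHalf.length * ‖act (CFC.sqrt (avg U T)) (c + t • b I)‖ ^ 2)) +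
          (ENNReal.ofReal (2 * κ) * E I.leftHalf + ENNReal.ofReal (2 * κ) * E I.rightHalf)) := by
          ring
      _ ≤ _ := by
          refine add_le_add le_rfl (mul_le_mul_right ?_ _)
          refine (add_le_add hsum le_rfl).trans ?_
          rw [add_assoc]
          refine add_le_add le_rfl ?_
          rw [← add_assoc]
          exact hEI

/-! ### From one top interval to the whole line. -/

lemma localHaarSum_eq_sum {b : DyadicInterval → Cn n} {F : Finset DyadicInterval}
    (hb : ∀ J ∉ F, b J = 0) (e : ℕ) (I : DyadicInterval) {x : ℝ} (hx : x ∈ I.toSet) :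
    localHaarSum b e I x =
      ∑ J ∈ F, if I.1 ≤ J.1 ∧ J.1 < I.1 + e then haar J x • b J else 0 := by
  induction e generalizing I with
  | zero =>
    rw [Finset.sum_eq_zero]
    · rfl
    · intro J _
      rw [if_neg]
      push_cast
      omega
  | succ e ih =>
    have h1 : ∑ J ∈ F, (if J = I then haar J x • b J else 0) = haar I x • b I := by
      rw [Finset.sum_ite_eq']
      split_ifs with h
      · rfl
      · rw [hb I h, smul_zero]
    have h2 : ∀ J ∈ F, (if I.1 ≤ J.1 ∧ J.1 < I.1 + ((e + 1 : ℕ) : ℤ) then haar J x • b J else 0) =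
        (if J = I then haar J x • b J else 0) +
          if I.1 + 1 ≤ J.1 ∧ J.1 < I.1 + 1 + e then haar J x • b J else 0 := by
      intro J _
      push_cast
      -- On the level of I only I itself contains x, so the other intervals of that level drop out.
      by_cases hJ : J.1 = I.1
      · rw [if_pos (by omega), if_neg (c := I.1 + 1 ≤ J.1 ∧ _) (by omega), add_zero]
        split_ifs with hJI
        · rfl
        · rw [haar_eq_zero, zero_smul]
          intro hxJ
          rw [mem_toSet_iff] at hx hxJ
          rw [hJ] at hxJ
          exact hJI (Prod.ext hJ (hxJ.symm.trans hx))
      · rw [if_neg (c := J = I) (fun h => hJ (by rw [h])), zero_add]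
        exact if_congr (by omega) rfl rfl
    rw [Finset.sum_congr rfl h2, Finset.sum_add_distrib, h1]
    rcases (mem_leftHalf_or_mem_rightHalf_iff I x).2 hx with h | h
    · rw [localHaarSum_succ_left b e I h, ih _ h, haar_eq_left h, neg_smul]
      rfl
    · rw [localHaarSum_succ_right b e I h, ih _ h, haar_eq_right h]
      rfl

open scoped Classical in
/-- The sum of `α J` over the intervals `J ∈ F` contained in `I`. -/
def localEnergy (F : Finset DyadicInterval) (α : DyadicInterval → ℝ) (I : DyadicInterval) : ℝ≥0∞ :=
  ∑ J ∈ F, if J.toSet ⊆ I.toSet then ENNReal.ofReal (α J) else 0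

/-- I and its two halves claim disjoint families of subintervals. Only this inequality is needed,
not that the families exhaust those inside I. -/
lemma localEnergy_superadditive {F : Finset DyadicInterval} {α : DyadicInterval → ℝ}
    (hα : ∀ J ∉ F, α J = 0) (I : DyadicInterval) :
    ENNReal.ofReal (α I) + localEnergy F α I.leftHalf + localEnergy F α I.rightHalf ≤
      localEnergy F α I := by
  classical
  have h1 : ENNReal.ofReal (α I) = ∑ J ∈ F, if J = I then ENNReal.ofReal (α J) else 0 := by
    rw [Finset.sum_ite_eq']
    split_ifs with h
    · rfl
    · rw [hα I h, ENNReal.ofReal_zero]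
  unfold localEnergy
  rw [h1, ← Finset.sum_add_distrib, ← Finset.sum_add_distrib]
  refine Finset.sum_le_sum fun J _ => ?_
  have hd := Set.disjoint_left.1 (disjoint_halves I)
  obtain ⟨y, hy⟩ := toSet_nonempty J
  obtain ⟨l, hl⟩ := toSet_nonempty I.leftHalf
  obtain ⟨r, hr⟩ := toSet_nonempty I.rightHalf
  have hle := leftHalf_subset I
  have hre := rightHalf_subset I
  by_cases hJI : J = I
  · subst hJI
    rw [if_pos rfl, if_neg fun h => hd (h (hre hr)) hr, if_neg fun h => hd hl (h (hle hl)),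
      if_pos subset_rfl, add_zero, add_zero]
  · rw [if_neg hJI, zero_add]
    by_cases hJl : J.toSet ⊆ I.leftHalf.toSet
    · rw [if_pos hJl, if_neg fun h => hd (hJl hy) (h hy), if_pos (hJl.trans hle), add_zero]
    · rw [if_neg hJl, zero_add]
      split_ifs with h1 h2 h2
      · exact le_rfl
      · exact absurd (h1.trans hre) h2
      · exact zero_le
      · exact le_rfl

/-- A point of J determines the only interval of level m that can contain J, so each J is counted at
most once. -/
lemma tsum_localEnergy_le (F : Finset DyadicInterval) (α : DyadicInterval → ℝ) (m : ℤ) :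
    ∑' k : ℤ, localEnergy F α (m, k) ≤ ∑ J ∈ F, ENNReal.ofReal (α J) := by
  classical
  unfold localEnergy
  rw [Summable.tsum_finsetSum fun _ _ => ENNReal.summable]
  refine Finset.sum_le_sum fun J _ => ?_
  obtain ⟨y, hy⟩ := toSet_nonempty J
  calc ∑' k : ℤ, (if J.toSet ⊆ toSet (m, k) then ENNReal.ofReal (α J) else 0)
      ≤ ∑' k : ℤ, if k = index m y then ENNReal.ofReal (α J) else 0 := by
        refine ENNReal.tsum_le_tsum fun k => ?_
        split_ifs with h1 h2 h2
        · exact le_rfl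
        · exact absurd ((mem_toSet_iff _ _).1 (h1 hy)).symm h2
        · exact zero_le
        · exact le_rfl
    _ = _ := tsum_ite_eq _ _

/-- The bound for the two-weighted square function on finite Haar sums, in terms of the
coefficients. -/
theorem exists_lintegral_squareFunction_le {U W : ℝ → Matrix (Fin n) (Fin n) ℂ}
    (hU : IsMatrixWeight U) (hW : IsMatrixWeight W) (hUint : IsLocIntegrable U)
    (hWint : IsLocIntegrable W) (hRH : DyadicReverseHolder U) (hA2 : DyadicJointA2 U W) :
    ∃ K : ℝ, 0 ≤ K ∧ ∀ (F : Finset DyadicInterval) (a : DyadicInterval → Cn n),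
      (∀ J ∉ F, a J = 0) →
      ∫⁻ x, ENNReal.ofReal (‖act (CFC.sqrt (U x))
        (∑ J ∈ F, haar J x • act (CFC.sqrt (avg W J)) (a J))‖ ^ 2) ≤
        ENNReal.ofReal K * ∑ J ∈ F, ENNReal.ofReal (‖a J‖ ^ 2) := by
  obtain ⟨κ, hκ, hself⟩ := exists_spread_self_le hU hUint hA2
  obtain ⟨C, hC, r, hr, hRH⟩ := hRH
  have hr0 : 0 < r := by linarith
  have hθ0 : 0 < 1 - 2 / r := by
    rw [sub_pos, div_lt_one hr0]; exact hr
  -- The only use of r > 2: it makes θ = 1 - 2/r positive, hence ε > 0.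
  set ε : ℝ := (3 / 2 : ℝ) ^ (1 - 2 / r) - 1 with hε
  have hε0 : 0 < ε := sub_pos.2 (Real.one_lt_rpow (by norm_num) hθ0)
  have hweight : ∀ (e : ℕ) (I : DyadicInterval) (v : Cn n),
      ∫⁻ x in I.toSet, ENNReal.ofReal (stoppingWeight (spread U W) κ e I I x ^ (1 - 2 / r) *
        ‖act (CFC.sqrt (U x)) v‖ ^ 2) ≤
          ENNReal.ofReal ((4 + C) * (I.length * ‖act (CFC.sqrt (avg U I)) v‖ ^ 2)) := by
    intro e I v
    refine lintegral_rpow_mul_norm_act_sq_le hU hUint hC hr hRH I (measurable_stoppingWeight e I I)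
      (stoppingWeight_nonneg e I I) (by norm_num) ?_ v
    refine (lintegral_stoppingWeight_le hκ spread_nonneg hself
      (spread_halves hU hW hUint hWint) e I I).trans (ENNReal.ofReal_le_ofReal ?_)
    rw [mul_comm]
    have hI := length_pos I
    gcongr
    have : 3 * spread U W I I / κ ≤ 3 := by
      rw [div_le_iff₀ hκ]; linarith [hself I]
    linarith
  set K₁ : ℝ := 4 * κ * (1 + 2 * (1 + ε⁻¹) * (4 + C)) with hK₁
  have hK₁0 : 0 ≤ K₁ := by positivity
  refine ⟨K₁ * (2 * κ), by positivity, fun F a ha => ?_⟩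
  set b : DyadicInterval → Cn n := fun J => act (CFC.sqrt (avg W J)) (a J) with hb
  have hb0 : ∀ J ∉ F, b J = 0 := fun J hJ => by rw [hb]; simp only [ha J hJ, act_zero]
  obtain ⟨m, hm⟩ : ∃ m : ℤ, ∀ J ∈ F, m ≤ J.1 := by
    obtain ⟨m, hm⟩ := (F.image Prod.fst).bddBelow
    exact ⟨m, fun J hJ => hm (Finset.mem_coe.2 (Finset.mem_image_of_mem _ hJ))⟩
  obtain ⟨e, he⟩ : ∃ e : ℕ, ∀ J ∈ F, J.1 < m + e := by
    obtain ⟨M, hM⟩ := (F.image Prod.fst).bddAbove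
    -- The extra 1 is needed because depth e covers the levels m, …, m + e - 1.
    refine ⟨(M + 1 - m).toNat, fun J hJ => ?_⟩
    have := hM (Finset.mem_coe.2 (Finset.mem_image_of_mem _ hJ))
    have h2 := Int.self_le_toNat (M + 1 - m)
    omega
  have hsum : ∀ k : ℤ, ∀ x ∈ toSet (m, k),
      ∑ J ∈ F, haar J x • act (CFC.sqrt (avg W J)) (a J) = localHaarSum b e (m, k) x := by
    intro k x hx
    rw [localHaarSum_eq_sum hb0 e (m, k) hx]
    refine Finset.sum_congr rfl fun J hJ => ?_
    rw [if_pos ⟨hm J hJ, he J hJ⟩]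
  have hlocal : ∀ k : ℤ, ∫⁻ x in toSet (m, k), ENNReal.ofReal (‖act (CFC.sqrt (U x))
      (∑ J ∈ F, haar J x • act (CFC.sqrt (avg W J)) (a J))‖ ^ 2) ≤
        ENNReal.ofReal K₁ *
          (ENNReal.ofReal (2 * κ) * localEnergy F (fun J => ‖a J‖ ^ 2) (m, k)) := by
    intro k
    -- The induction starts with T = I and z = c = 0, so only the energy term survives.
    have h := lintegral_norm_act_localHaarSum_sq_le hU hUint hκ hself
      (norm_act_sqrt_avg_sq_le_spread hU hUint) (b := b) (α := fun J => ‖a J‖ ^ 2)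
      (fun _ => sq_nonneg _) (fun T I => norm_act_sqrt_avg_act_sq_le_spread T I (a I))
      (localEnergy_superadditive (F := F) fun J hJ => by simp [ha J hJ])
      hε0 (by rw [hε]; ring) (by positivity : 0 ≤ 4 + C) hweight e (m, k) (m, k)
      (by linarith [hself (m, k)]) 0 0
    simp only [act_zero, norm_zero, zero_add] at h
    rw [setLIntegral_congr_fun (measurableSet_toSet _) (fun x hx => by rw [hsum k x hx])]
    simpa using h
  rw [lintegral_eq_tsum m]
  calc _ ≤ ∑' k : ℤ, ENNReal.ofReal K₁ *
          (ENNReal.ofReal (2 * κ) * localEnergy F (fun J => ‖a J‖ ^ 2) (m, k)) :=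
        ENNReal.tsum_le_tsum hlocal
    _ = ENNReal.ofReal K₁ * (ENNReal.ofReal (2 * κ) *
          ∑' k : ℤ, localEnergy F (fun J => ‖a J‖ ^ 2) (m, k)) := by
        rw [ENNReal.tsum_mul_left, ENNReal.tsum_mul_left]
    _ ≤ ENNReal.ofReal K₁ * (ENNReal.ofReal (2 * κ) * ∑ J ∈ F, ENNReal.ofReal (‖a J‖ ^ 2)) := by
        gcongr
        exact tsum_localEnergy_le F _ m
    _ = _ := by rw [← mul_assoc, ← ENNReal.ofReal_mul hK₁0]

/-! ### Orthonormality of the Haar system and Parseval's identity. -/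

lemma haar_sq (I : DyadicInterval) (x : ℝ) :
    haar I x * haar I x = I.toSet.indicator (fun _ => (I.length)⁻¹) x := by
  have h : (Real.sqrt I.length)⁻¹ * (Real.sqrt I.length)⁻¹ = (I.length)⁻¹ := by
    rw [← mul_inv, Real.mul_self_sqrt (length_pos I).le]
  by_cases hx : x ∈ I.toSet
  · rw [Set.indicator_of_mem hx]
    rcases (mem_leftHalf_or_mem_rightHalf_iff I x).2 hx with h1 | h1
    · rw [haar_eq_left h1, neg_mul_neg, h]
    · rw [haar_eq_right h1, h]
  · rw [Set.indicator_of_notMem hx, haar_eq_zero hx, zero_mul]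

lemma volume_toSet_ne_top (I : DyadicInterval) : volume I.toSet ≠ ∞ := by
  rw [volume_toSet]; exact ENNReal.ofReal_ne_top

lemma memLp_haar (I : DyadicInterval) (p : ℝ≥0∞) : MemLp (haar I) p volume := by
  have h : ∀ J : DyadicInterval, MemLp (J.toSet.indicator fun _ => (1 : ℝ)) p volume := fun J =>
    memLp_indicator_const p (measurableSet_toSet J) 1 (Or.inr (volume_toSet_ne_top J))
  exact ((h _).sub (h _)).const_mul _

lemma measureReal_toSet (I : DyadicInterval) : volume.real I.toSet = I.length := by
  rw [measureReal_def, volume_toSet, ENNReal.toReal_ofReal (length_pos I).le]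

lemma integral_haar (I : DyadicInterval) : ∫ x, haar I x = 0 := by
  have h : ∀ J : DyadicInterval, Integrable (J.toSet.indicator fun _ => (1 : ℝ)) volume := fun J =>
    memLp_one_iff_integrable.1
      (memLp_indicator_const 1 (measurableSet_toSet J) 1 (Or.inr (volume_toSet_ne_top J)))
  unfold haar
  rw [integral_const_mul, integral_sub (h _) (h _), integral_indicator (measurableSet_toSet _),
    integral_indicator (measurableSet_toSet _)]
  simp [measureReal_toSet, length_leftHalf, length_rightHalf]

/-- The coarser Haar function is constant on the support of the finer one; orthogonality then
follows from the vanishing mean of the latter. -/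
lemma haar_mul_haar_of_lt {I J : DyadicInterval} (h : I.1 < J.1) {y : ℝ} (hy : y ∈ J.toSet)
    (x : ℝ) : haar I x * haar J x = haar I y * haar J x := by
  by_cases hx : x ∈ J.toSet
  · rw [haar_eq_of_index_eq (I := I) (x := x) (y := y)]
    rw [mem_toSet_iff] at hx hy
    exact index_eq_of_le (m' := J.1) (by omega) (hx.trans hy.symm)
  · rw [haar_eq_zero hx, mul_zero, mul_zero]

lemma integral_haar_mul_haar (I J : DyadicInterval) :
    ∫ x, haar I x * haar J x = if I = J then 1 else 0 := by
  have key : ∀ I J : DyadicInterval, I.1 < J.1 → ∫ x, haar I x * haar J x = 0 := by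
    intro I J h
    obtain ⟨y, hy⟩ := toSet_nonempty J
    simp only [haar_mul_haar_of_lt h hy]
    rw [integral_const_mul, integral_haar, mul_zero]
  split_ifs with hIJ
  · subst hIJ
    simp only [haar_sq]
    rw [integral_indicator (measurableSet_toSet _)]
    simp [measureReal_toSet, (length_pos I).ne']
  · rcases lt_trichotomy I.1 J.1 with h | h | h
    · exact key I J h
    · have h0 : ∀ x, haar I x * haar J x = 0 := by
        intro x
        by_cases hx : x ∈ I.toSet
        · rw [haar_eq_zero (I := J), mul_zero]
          intro hxJ
          rw [mem_toSet_iff] at hx hxJ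
          exact hIJ (Prod.ext h (by rw [← hx, ← hxJ, h]))
        · rw [haar_eq_zero hx, zero_mul]
      simp [h0]
    · simp only [mul_comm (haar I _)]
      exact key J I h

lemma integrable_haar_mul_haar (I J : DyadicInterval) :
    Integrable (fun x => haar I x * haar J x) volume :=
  (memLp_haar I 2).integrable_mul (memLp_haar J 2)

lemma integrable_haar_smul {f : ℝ → Cn n} (hf : MemLp f 2 volume) (I : DyadicInterval) :
    Integrable (fun x => haar I x • f x) volume :=
  memLp_one_iff_integrable.1 (hf.smul (memLp_haar I 2))

lemma memLp_haarSum (F : Finset DyadicInterval) (a : DyadicInterval → Cn n) :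
    MemLp (fun x => ∑ J ∈ F, haar J x • a J) 2 volume :=
  memLp_finsetSum F fun J _ =>
    MemLp.smul (φ := haar J) (f := fun _ => a J) (p := 2) (q := ∞) (memLp_top_const (a J))
      (memLp_haar J 2)

lemma haarCoeff_congr {f g : ℝ → Cn n} (h : f =ᵐ[volume] g) (I : DyadicInterval) :
    haarCoeff f I = haarCoeff g I := by
  refine integral_congr_ae ?_
  filter_upwards [h] with x hx
  rw [hx]

lemma haarCoeff_add {f g : ℝ → Cn n} (hf : MemLp f 2 volume) (hg : MemLp g 2 volume)
    (I : DyadicInterval) : haarCoeff (f + g) I = haarCoeff f I + haarCoeff g I := by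
  unfold haarCoeff
  rw [← integral_add (integrable_haar_smul hf I) (integrable_haar_smul hg I)]
  simp only [Pi.add_apply, smul_add]

lemma haarCoeff_smul (c : ℂ) (f : ℝ → Cn n) (I : DyadicInterval) :
    haarCoeff (c • f) I = c • haarCoeff f I := by
  unfold haarCoeff
  rw [← integral_smul]
  simp only [Pi.smul_apply, smul_comm c]

lemma haarCoeff_haarSum (F : Finset DyadicInterval) (a : DyadicInterval → Cn n)
    (I : DyadicInterval) :
    haarCoeff (fun x => ∑ J ∈ F, haar J x • a J) I = if I ∈ F then a I else 0 := by
  unfold haarCoeff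
  simp only [Finset.smul_sum, smul_smul]
  rw [integral_finsetSum _ fun J _ => (integrable_haar_mul_haar I J).smul_const (a J)]
  simp only [integral_smul_const, integral_haar_mul_haar, ite_smul, one_smul, zero_smul]
  rw [Finset.sum_ite_eq]

/-- Orthonormality identifies the a_J with the Haar coefficients, so every finite Haar combination
qualifies. -/
lemma hasFiniteHaarExpansion_of_ae_eq {f : ℝ → Cn n} {F : Finset DyadicInterval}
    {a : DyadicInterval → Cn n} (h : f =ᵐ[volume] fun x => ∑ J ∈ F, haar J x • a J) :
    HasFiniteHaarExpansion f := by
  refine ⟨F, h.trans (Filter.Eventually.of_forall fun x => ?_)⟩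
  refine Finset.sum_congr rfl fun J hJ => ?_
  rw [haarCoeff_congr h J, haarCoeff_haarSum, if_pos hJ]

lemma haarCoeff_eq_zero {f : ℝ → Cn n} {F : Finset DyadicInterval}
    (h : f =ᵐ[volume] fun x => ∑ J ∈ F, haar J x • haarCoeff f J) {I : DyadicInterval}
    (hI : I ∉ F) : haarCoeff f I = 0 := by
  rw [haarCoeff_congr h I, haarCoeff_haarSum, if_neg hI]

lemma haarExpansion_mono {f : ℝ → Cn n} {F G : Finset DyadicInterval} (hFG : F ⊆ G)
    (h : f =ᵐ[volume] fun x => ∑ J ∈ F, haar J x • haarCoeff f J) :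
    f =ᵐ[volume] fun x => ∑ J ∈ G, haar J x • haarCoeff f J := by
  refine h.trans (Filter.Eventually.of_forall fun x => ?_)
  refine Finset.sum_subset hFG fun J _ hJ => ?_
  rw [haarCoeff_eq_zero h hJ, smul_zero]

lemma inner_haarCoeff {f : ℝ → Cn n} (hf : MemLp f 2 volume) (I : DyadicInterval) (v : Cn n) :
    ∫ x, inner ℂ (haar I x • v) (f x) = inner ℂ v (haarCoeff f I) := by
  unfold haarCoeff
  rw [← integral_inner (integrable_haar_smul hf I)]
  refine integral_congr_ae (Filter.Eventually.of_forall fun x => ?_)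
  simp only [inner_smul_left_eq_star_smul, inner_smul_right_eq_smul, starRingEnd_apply, star_trivial]

/-- Parseval's identity for finite Haar expansions. -/
lemma sum_norm_haarCoeff_sq (f : Lp (Cn n) 2 (volume : Measure ℝ)) {F : Finset DyadicInterval}
    (h : f =ᵐ[volume] fun x => ∑ J ∈ F, haar J x • haarCoeff f J) :
    ∑ J ∈ F, ‖haarCoeff f J‖ ^ 2 = ‖f‖ ^ 2 := by
  have h1 : inner ℂ f f = ∑ J ∈ F, inner ℂ (haarCoeff f J) (haarCoeff f J) := by
    rw [L2.inner_def]
    have hi : ∀ J ∈ F, Integrable (fun x => inner ℂ (haar J x • haarCoeff f J) (f x)) volume := by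
      intro J _
      have := (integrable_haar_smul (Lp.memLp f) J).const_inner (𝕜 := ℂ) (haarCoeff f J)
      refine this.congr (Filter.Eventually.of_forall fun x => ?_)
      simp only [inner_smul_left_eq_star_smul, inner_smul_right_eq_smul, starRingEnd_apply, star_trivial]
    have : ∫ x, inner ℂ (f x) (f x) =
        ∫ x, ∑ J ∈ F, inner ℂ (haar J x • haarCoeff f J) (f x) := by
      refine integral_congr_ae ?_
      filter_upwards [h] with x hx
      rw [← sum_inner, ← hx]
    rw [this, integral_finsetSum _ hi]
    exact Finset.sum_congr rfl fun J _ => inner_haarCoeff (Lp.memLp f) J _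
  simp only [inner_self_eq_norm_sq_to_K] at h1
  exact_mod_cast h1.symm

/-- The functions in `L²` with finite Haar expansion. -/
def finiteHaar (n : ℕ) : Submodule ℂ (Lp (Cn n) 2 (volume : Measure ℝ)) where
  carrier := {f | HasFiniteHaarExpansion f}
  zero_mem' := ⟨∅, by simpa [Pi.zero_def] using Lp.coeFn_zero (Cn n) 2 volume⟩
  add_mem' := by
    rintro f g ⟨F, hF⟩ ⟨G, hG⟩
    classical
    refine hasFiniteHaarExpansion_of_ae_eq (F := F ∪ G)
      (a := fun J => haarCoeff f J + haarCoeff g J) ?_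
    filter_upwards [Lp.coeFn_add f g, haarExpansion_mono Finset.subset_union_left hF,
      haarExpansion_mono Finset.subset_union_right hG] with x hx h1 h2
    rw [hx, Pi.add_apply, h1, h2, ← Finset.sum_add_distrib]
    simp only [smul_add]
  smul_mem' := by
    rintro c f ⟨F, hF⟩
    refine hasFiniteHaarExpansion_of_ae_eq (F := F) (a := fun J => c • haarCoeff f J) ?_
    filter_upwards [Lp.coeFn_smul c f, hF] with x hx h1
    rw [hx, Pi.smul_apply, h1, Finset.smul_sum]
    simp only [smul_comm c]

/-! ### Completeness of the Haar system. -/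

lemma haarCoeff_eq_sub {f : ℝ → Cn n} (hf : MemLp f 2 volume) (I : DyadicInterval) :
    haarCoeff f I = (Real.sqrt I.length)⁻¹ •
      ((∫ x in I.rightHalf.toSet, f x) - ∫ x in I.leftHalf.toSet, f x) := by
  have hloc := hf.locallyIntegrable (by norm_num)
  have hi : ∀ J : DyadicInterval, Integrable (J.toSet.indicator f) volume := fun J =>
    (integrableOn_of_locallyIntegrable hloc J).integrable_indicator (measurableSet_toSet J)
  rw [← integral_indicator (measurableSet_toSet _), ← integral_indicator (measurableSet_toSet _),
    ← integral_sub (hi _) (hi _), ← integral_smul]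
  refine integral_congr_ae (Filter.Eventually.of_forall fun x => ?_)
  simp only [haar, Set.indicator, mul_smul, sub_smul, ite_smul, one_smul, zero_smul]

lemma norm_setIntegral_toSet_le (f : Lp (Cn n) 2 (volume : Measure ℝ)) (I : DyadicInterval) :
    ‖∫ x in I.toSet, f x‖ ≤ ‖f‖ * Real.sqrt I.length := by
  have h1 : ‖∫ x in I.toSet, f x‖ₑ ≤ ENNReal.ofReal (‖f‖ * Real.sqrt I.length) := by
    calc ‖∫ x in I.toSet, f x‖ₑ ≤ eLpNorm f 1 (volume.restrict I.toSet) := by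
          rw [eLpNorm_one_eq_lintegral_enorm]
          exact enorm_integral_le_lintegral_enorm _
      _ ≤ eLpNorm f 2 (volume.restrict I.toSet) *
          (volume.restrict I.toSet) Set.univ ^ (1 / (1 : ℝ≥0∞).toReal - 1 / (2 : ℝ≥0∞).toReal) :=
          eLpNorm_le_eLpNorm_mul_rpow_measure_univ (by norm_num)
            (Lp.aestronglyMeasurable f).restrict
      _ ≤ eLpNorm f 2 volume * ENNReal.ofReal (Real.sqrt I.length) := by
          rw [Measure.restrict_apply_univ, volume_toSet, Real.sqrt_eq_rpow,
            ← ENNReal.ofReal_rpow_of_pos (length_pos I)]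
          refine mul_le_mul' (eLpNorm_mono_measure _ Measure.restrict_le_self) (le_of_eq ?_)
          norm_num
      _ = _ := by
          rw [ENNReal.ofReal_mul (norm_nonneg _), Lp.norm_def,
            ENNReal.ofReal_toReal (Lp.eLpNorm_ne_top f)]
  rw [← ofReal_norm] at h1
  exact (ENNReal.ofReal_le_ofReal_iff (by positivity)).1 h1

/-- Vanishing coefficients make the integrals over the two halves equal, so the mean over I equals
the mean over each ancestor. By Cauchy--Schwarz the mean of an L² function over an interval of
length L is O(L^{-1/2}), which tends to 0. -/
lemma setIntegral_toSet_eq_zero (f : Lp (Cn n) 2 (volume : Measure ℝ))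
    (h : ∀ I, haarCoeff f I = 0) (I : DyadicInterval) : ∫ x in I.toSet, f x = 0 := by
  have hloc := (Lp.memLp f).locallyIntegrable (by norm_num : (1 : ℝ≥0∞) ≤ 2)
  have hhalf : ∀ J : DyadicInterval, ∫ x in J.rightHalf.toSet, f x = ∫ x in J.leftHalf.toSet, f x := by
    intro J
    have h1 := haarCoeff_eq_sub (Lp.memLp f) J
    rw [h J, eq_comm, smul_eq_zero] at h1
    rcases h1 with h1 | h1
    · exact absurd h1 (inv_ne_zero (Real.sqrt_pos.2 (length_pos J)).ne')
    · exact sub_eq_zero.1 h1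
  have hpar : ∀ J : DyadicInterval, ∫ x in J.toSet, f x = (2 : ℝ) • ∫ x in J.leftHalf.toSet, f x := by
    intro J
    rw [toSet_eq_union J, setIntegral_union (disjoint_halves J) (measurableSet_toSet _)
      (integrableOn_of_locallyIntegrable hloc _) (integrableOn_of_locallyIntegrable hloc _),
      hhalf J, two_smul]
  have hstep : ∀ (m k : ℤ), ∫ x in toSet (m, k / 2), f x = (2 : ℝ) • ∫ x in toSet (m + 1, k), f x := by
    intro m k
    rw [hpar]
    rcases Int.emod_two_eq_zero_or_one k with hk | hk
    · have hJ : leftHalf (m, k / 2) = (m + 1, k) :=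
        Prod.ext rfl (by change 2 * (k / 2) = k; omega)
      rw [hJ]
    · have hJ : rightHalf (m, k / 2) = (m + 1, k) :=
        Prod.ext rfl (by change 2 * (k / 2) + 1 = k; omega)
      rw [← hhalf, hJ]
  have hiter : ∀ (j : ℕ) (m k : ℤ), ∃ k', ∫ x in toSet (m, k), f x =
      ((2 : ℝ) ^ j)⁻¹ • ∫ x in toSet (m - j, k'), f x := by
    intro j
    induction j with
    | zero => intro m k; exact ⟨k, by simp⟩
    | succ j ih =>
      intro m k
      obtain ⟨k', hk'⟩ := ih m k
      refine ⟨k' / 2, ?_⟩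
      have h1 := hstep (m - (j + 1 : ℕ)) k'
      have h2 : m - ((j + 1 : ℕ) : ℤ) + 1 = m - j := by push_cast; ring
      rw [h2] at h1
      rw [hk', h1, smul_smul]
      congr 1
      rw [pow_succ]
      field_simp
  have hbound : ∀ j : ℕ, ‖∫ x in I.toSet, f x‖ ≤
      ‖f‖ * Real.sqrt I.length * (Real.sqrt 2)⁻¹ ^ j := by
    intro j
    obtain ⟨k', hk'⟩ := hiter j I.1 I.2
    change ∫ x in I.toSet, f x = _ at hk'
    rw [hk', norm_smul]
    have h1 := norm_setIntegral_toSet_le f (I.1 - j, k')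
    have h2 : length (I.1 - j, k') = I.length * 2 ^ j := by
      simp only [length, neg_sub]
      rw [sub_eq_neg_add, zpow_add₀ two_ne_zero, zpow_natCast]
    rw [h2, Real.sqrt_mul (length_pos I).le] at h1
    have h3 : Real.sqrt (2 ^ j) = Real.sqrt 2 ^ j := by
      rw [Real.sqrt_eq_iff_mul_self_eq (by positivity) (by positivity), ← mul_pow,
        Real.mul_self_sqrt zero_le_two]
    have h4 : (2 : ℝ) ^ j = Real.sqrt 2 ^ j * Real.sqrt 2 ^ j := by
      rw [← mul_pow, Real.mul_self_sqrt zero_le_two]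
    rw [h3] at h1
    have hs : 0 < Real.sqrt 2 ^ j := by positivity
    rw [Real.norm_of_nonneg (by positivity)]
    calc ((2 : ℝ) ^ j)⁻¹ * ‖∫ x in toSet (I.1 - j, k'), f x‖
        ≤ ((2 : ℝ) ^ j)⁻¹ * (‖f‖ * (Real.sqrt I.length * Real.sqrt 2 ^ j)) := by gcongr
      _ = _ := by rw [h4, inv_pow]; field_simp
  have hlim : Filter.Tendsto (fun j : ℕ => ‖f‖ * Real.sqrt I.length * (Real.sqrt 2)⁻¹ ^ j)
      Filter.atTop (nhds 0) := by
    rw [← mul_zero (‖f‖ * Real.sqrt I.length)]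
    refine (tendsto_pow_atTop_nhds_zero_of_lt_one (by positivity) ?_).const_mul _
    refine inv_lt_one_of_one_lt₀ ?_
    rw [Real.lt_sqrt zero_le_one]; norm_num
  exact norm_le_zero_iff.1 (ge_of_tendsto' hlim hbound)

/-- Completeness of the Haar system. -/
lemma eq_zero_of_haarCoeff_eq_zero (f : Lp (Cn n) 2 (volume : Measure ℝ))
    (h : ∀ I, haarCoeff f I = 0) : f = 0 := by
  have hloc := (Lp.memLp f).locallyIntegrable (by norm_num : (1 : ℝ≥0∞) ≤ 2)
  have hii : ∀ a b : ℝ, IntervalIntegrable f volume a b := fun a b =>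
    (hloc.integrableOn_isCompact isCompact_uIcc).intervalIntegrable
  -- The primitive of f vanishes at the dyadic points, hence everywhere by continuity; Lebesgue
  -- differentiation then gives f = 0 almost everywhere.
  have hgrid : ∀ m k : ℤ, ∫ t in (0 : ℝ)..(k * (2 : ℝ) ^ (-m)), f t = 0 := by
    intro m k
    have hs : ∀ k : ℤ, ∫ t in (k * (2 : ℝ) ^ (-m))..((k + 1) * (2 : ℝ) ^ (-m)), f t = 0 := by
      intro k
      have h1 := setIntegral_toSet_eq_zero f h (m, k)
      have hp : (0 : ℝ) < 2 ^ (-m) := by positivity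
      rw [intervalIntegral.integral_of_le (by nlinarith), ← integral_Ico_eq_integral_Ioc]
      exact h1
    induction k using Int.induction_on with
    | zero => simp
    | succ k ih =>
      rw [← intervalIntegral.integral_add_adjacent_intervals (hii _ _) (hii _ _), ih, zero_add]
      exact_mod_cast hs k
    | pred k ih =>
      have h2 := hs (-k - 1)
      rw [← intervalIntegral.integral_add_adjacent_intervals (hii _ _)
        (hii ((-(k : ℝ) - 1) * (2 : ℝ) ^ (-m)) _)] at ih
      push_cast at h2 ih ⊢
      rw [sub_add_cancel] at h2
      rwa [h2, add_zero] at ih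
  have hprim : ∀ x : ℝ, ∫ t in (0 : ℝ)..x, f t = 0 := by
    intro x
    have hcont : Continuous fun x : ℝ => ∫ t in (0 : ℝ)..x, f t :=
      intervalIntegral.continuous_primitive hii 0
    have hx : Filter.Tendsto (fun m : ℕ => (⌊x * 2 ^ m⌋ : ℝ) * (2 : ℝ) ^ (-(m : ℤ)))
        Filter.atTop (nhds x) := by
      have h2 : Filter.Tendsto (fun m : ℕ => x - (1 / 2 : ℝ) ^ m) Filter.atTop (nhds x) := by
        simpa using (tendsto_pow_atTop_nhds_zero_of_lt_one (r := (1 / 2 : ℝ)) (by norm_num)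
          (by norm_num)).const_sub x
      refine tendsto_of_tendsto_of_tendsto_of_le_of_le h2 tendsto_const_nhds (fun m => ?_)
        fun m => ?_
      · have h3 := Int.sub_one_lt_floor (x * 2 ^ m)
        have hp : (0 : ℝ) < 2 ^ m := by positivity
        simp only [zpow_neg, zpow_natCast, one_div, inv_pow]
        rw [← div_eq_mul_inv, le_div_iff₀ hp, sub_mul, inv_mul_cancel₀ hp.ne']
        exact h3.le
      · have h3 := Int.floor_le (x * 2 ^ m)
        have hp : (0 : ℝ) < 2 ^ m := by positivity
        simp only [zpow_neg, zpow_natCast]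
        rw [← div_eq_mul_inv, div_le_iff₀ hp]
        exact h3
    have h4 := (hcont.tendsto x).comp hx
    refine tendsto_nhds_unique h4 ?_
    simp only [Function.comp_def, hgrid]
    exact tendsto_const_nhds
  refine (Lp.eq_zero_iff_ae_eq_zero).2 ?_
  filter_upwards [LocallyIntegrable.ae_hasDerivAt_integral hloc] with x hx
  have h1 := hx 0
  simp only [hprim] at h1
  exact h1.unique (hasDerivAt_const x 0)

/-- Testing f in the orthogonal complement against f_I h_I gives ‖f_I‖² = 0 for every I, and
completeness applies. -/
lemma dense_finiteHaar (n : ℕ) : Dense (finiteHaar n : Set (Lp (Cn n) 2 (volume : Measure ℝ))) := by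
  rw [Submodule.dense_iff_topologicalClosure_eq_top, Submodule.topologicalClosure_eq_top_iff,
    Submodule.eq_bot_iff]
  intro f hf
  refine eq_zero_of_haarCoeff_eq_zero f fun I => ?_
  have hm : MemLp (fun x => ∑ J ∈ {I}, haar J x • haarCoeff f I) 2 volume :=
    memLp_haarSum {I} fun _ => haarCoeff f I
  have hg : hm.toLp _ ∈ finiteHaar n := hasFiniteHaarExpansion_of_ae_eq hm.coeFn_toLp
  have h1 := (Submodule.mem_orthogonal _ _).1 hf _ hg
  rw [L2.inner_def] at h1
  have h2 : ∫ x, inner ℂ (hm.toLp _ x) (f x) = inner ℂ (haarCoeff f I) (haarCoeff f I) := by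
    rw [← inner_haarCoeff (Lp.memLp f)]
    refine integral_congr_ae ?_
    filter_upwards [hm.coeFn_toLp] with x hx
    rw [hx, Finset.sum_singleton]
  rw [h2] at h1
  exact inner_self_eq_zero.1 h1

/-! ### The square function as a bounded operator. -/

lemma eLpNorm_two_le_of_lintegral_sq_le {E : Type*} [NormedAddCommGroup E] {g : ℝ → E} {M : ℝ}
    (hM : 0 ≤ M) (h : ∫⁻ x, ENNReal.ofReal (‖g x‖ ^ 2) ≤ ENNReal.ofReal (M ^ 2)) :
    eLpNorm g 2 volume ≤ ENNReal.ofReal M := by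
  rw [eLpNorm_eq_lintegral_rpow_enorm_toReal two_ne_zero ENNReal.ofNat_ne_top]
  have h1 : ∀ x, ‖g x‖ₑ ^ (2 : ℝ≥0∞).toReal = ENNReal.ofReal (‖g x‖ ^ 2) := by
    intro x
    rw [← ofReal_norm, ENNReal.ofReal_pow (norm_nonneg _)]
    norm_num
  simp only [h1]
  calc _ ≤ (ENNReal.ofReal (M ^ 2)) ^ (1 / (2 : ℝ≥0∞).toReal) := by gcongr
    _ = ENNReal.ofReal M := by
      rw [ENNReal.ofReal_rpow_of_nonneg (by positivity) (by norm_num)]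
      congr 1
      rw [← Real.rpow_natCast, ← Real.rpow_mul hM]
      norm_num

/-- S sees f only through its Haar coefficients, so the formula holds at every x and for any finite
F carrying the coefficients. A common F then gives linearity pointwise. -/
lemma squareFunction_eq {U V : ℝ → Matrix (Fin n) (Fin n) ℂ} {f : ℝ → Cn n}
    {F : Finset DyadicInterval} (hF : ∀ J ∉ F, haarCoeff f J = 0) (x : ℝ) :
    squareFunction U V f x = act (CFC.sqrt (U x))
      (∑ J ∈ F, haar J x • act (CFC.sqrt (avg (fun t => (V t)⁻¹) J)) (haarCoeff f J)) := by
  unfold squareFunction haarMultiplier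
  rw [finsum_eq_sum_of_support_subset]
  intro J hJ
  by_contra h
  exact hJ (by simp only [hF J h, act_zero, smul_zero])

lemma squareFunction_add {U V : ℝ → Matrix (Fin n) (Fin n) ℂ}
    {f g : Lp (Cn n) 2 (volume : Measure ℝ)} (hf : f ∈ finiteHaar n) (hg : g ∈ finiteHaar n)
    (x : ℝ) : squareFunction U V (f + g : Lp (Cn n) 2 (volume : Measure ℝ)) x =
      squareFunction U V f x + squareFunction U V g x := by
  classical
  obtain ⟨F, hF⟩ := hf
  obtain ⟨G, hG⟩ := hg
  have hc : ∀ J, haarCoeff (f + g : Lp (Cn n) 2 (volume : Measure ℝ)) J =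
      haarCoeff f J + haarCoeff g J := fun J => by
    rw [haarCoeff_congr (Lp.coeFn_add f g), haarCoeff_add (Lp.memLp f) (Lp.memLp g)]
  have h1 : ∀ J ∉ F ∪ G, haarCoeff f J = 0 := fun J hJ =>
    haarCoeff_eq_zero hF fun h => hJ (Finset.mem_union_left _ h)
  have h2 : ∀ J ∉ F ∪ G, haarCoeff g J = 0 := fun J hJ =>
    haarCoeff_eq_zero hG fun h => hJ (Finset.mem_union_right _ h)
  rw [squareFunction_eq h1, squareFunction_eq h2, squareFunction_eq (F := F ∪ G)
    (fun J hJ => by rw [hc, h1 J hJ, h2 J hJ, add_zero]), ← act_add, ← Finset.sum_add_distrib]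
  simp only [hc, act_add, smul_add]

lemma squareFunction_smul {U V : ℝ → Matrix (Fin n) (Fin n) ℂ} (c : ℂ)
    {f : Lp (Cn n) 2 (volume : Measure ℝ)} (hf : f ∈ finiteHaar n) (x : ℝ) :
    squareFunction U V (c • f : Lp (Cn n) 2 (volume : Measure ℝ)) x =
      c • squareFunction U V f x := by
  obtain ⟨F, hF⟩ := hf
  have hc : ∀ J, haarCoeff (c • f : Lp (Cn n) 2 (volume : Measure ℝ)) J = c • haarCoeff f J :=
    fun J => by rw [haarCoeff_congr (Lp.coeFn_smul c f), haarCoeff_smul]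
  have h1 : ∀ J ∉ F, haarCoeff f J = 0 := fun J hJ => haarCoeff_eq_zero hF hJ
  rw [squareFunction_eq h1, squareFunction_eq (F := F)
    (fun J hJ => by rw [hc, h1 J hJ, smul_zero]), ← act_smul, Finset.smul_sum]
  simp only [hc, act_smul, smul_comm c]

lemma aestronglyMeasurable_squareFunction {U V : ℝ → Matrix (Fin n) (Fin n) ℂ}
    (hU : IsMatrixWeight U) {f : Lp (Cn n) 2 (volume : Measure ℝ)} (hf : f ∈ finiteHaar n) :
    AEStronglyMeasurable (squareFunction U V f) volume := by
  obtain ⟨F, hF⟩ := hf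
  have h : squareFunction U V f = _ := funext (squareFunction_eq fun J hJ => haarCoeff_eq_zero hF hJ)
  rw [h]
  refine (aemeasurable_act_sqrt hU ?_).aestronglyMeasurable
  exact (memLp_haarSum F _).aestronglyMeasurable.aemeasurable

lemma exists_eLpNorm_squareFunction_le {U V : ℝ → Matrix (Fin n) (Fin n) ℂ}
    (hU : IsMatrixWeight U) (hV : IsMatrixWeight (fun x => (V x)⁻¹)) (hUint : IsLocIntegrable U)
    (hVint : IsLocIntegrable (fun x => (V x)⁻¹)) (hRH : DyadicReverseHolder U)
    (hA2 : DyadicJointA2 U (fun x => (V x)⁻¹)) :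
    ∃ M : ℝ, 0 ≤ M ∧ ∀ f ∈ finiteHaar n,
      eLpNorm (squareFunction U V f) 2 volume ≤ ENNReal.ofReal (M * ‖f‖) := by
  obtain ⟨K, hK0, hK⟩ := exists_lintegral_squareFunction_le hU hV hUint hVint hRH hA2
  refine ⟨Real.sqrt K, Real.sqrt_nonneg K, ?_⟩
  rintro f ⟨F, hF⟩
  have h0 : ∀ J ∉ F, haarCoeff f J = 0 := fun J hJ => haarCoeff_eq_zero hF hJ
  refine eLpNorm_two_le_of_lintegral_sq_le (by positivity) ?_
  simp only [squareFunction_eq h0]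
  refine (hK F (haarCoeff f) h0).trans (le_of_eq ?_)
  rw [← ENNReal.ofReal_sum_of_nonneg fun J _ => sq_nonneg _, sum_norm_haarCoeff_sq f hF,
    ← ENNReal.ofReal_mul hK0, mul_pow, Real.sq_sqrt hK0]

end MatrixWeights

end

theorem theorem5p1 (n : ℕ) (U V : ℝ → Matrix (Fin n) (Fin n) ℂ)
    (hU : MatrixWeights.IsMatrixWeight U)
    (hV : MatrixWeights.IsMatrixWeight (fun x => (V x)⁻¹))
    (hUint : MatrixWeights.IsLocIntegrable U)
    (hVint : MatrixWeights.IsLocIntegrable (fun x => (V x)⁻¹))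
    (hRH : MatrixWeights.DyadicReverseHolder U)
    (hA2 : MatrixWeights.DyadicJointA2 U (fun x => (V x)⁻¹)) :
    ∃! T : Lp (MatrixWeights.Cn n) 2 (volume : Measure ℝ) →L[ℂ]
        Lp (MatrixWeights.Cn n) 2 (volume : Measure ℝ),
      ∀ f : Lp (MatrixWeights.Cn n) 2 (volume : Measure ℝ),
        MatrixWeights.HasFiniteHaarExpansion f →
          T f =ᵐ[volume] MatrixWeights.squareFunction U V f := by
  obtain ⟨M, hM0, hM⟩ := MatrixWeights.exists_eLpNorm_squareFunction_le hU hV hUint hVint hRH hA2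
  have hmem : ∀ f : MatrixWeights.finiteHaar n, MemLp (MatrixWeights.squareFunction U V f.1) 2 volume :=
    fun f => ⟨MatrixWeights.aestronglyMeasurable_squareFunction hU f.2,
      (hM f.1 f.2).trans_lt ENNReal.ofReal_lt_top⟩
  let S : MatrixWeights.finiteHaar n →ₗ[ℂ] Lp (MatrixWeights.Cn n) 2 (volume : Measure ℝ) :=
    { toFun := fun f => (hmem f).toLp _
      map_add' := fun f g => by
        rw [← MemLp.toLp_add]
        exact MemLp.toLp_congr _ _ (Filter.Eventually.of_forall fun x =>
          MatrixWeights.squareFunction_add f.2 g.2 x)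
      map_smul' := fun c f => by
        rw [RingHom.id_apply, ← MemLp.toLp_const_smul]
        exact MemLp.toLp_congr _ _ (Filter.Eventually.of_forall fun x =>
          MatrixWeights.squareFunction_smul c f.2 x) }
  have hSM : ∃ C, ∀ f, ‖S f‖ ≤ C * ‖(MatrixWeights.finiteHaar n).subtype f‖ := by
    refine ⟨M, fun f => ?_⟩
    change ‖(hmem f).toLp _‖ ≤ _
    rw [Lp.norm_toLp]
    exact ENNReal.toReal_le_of_le_ofReal (by positivity) (hM f.1 f.2)
  have hdense : DenseRange (MatrixWeights.finiteHaar n).subtype := by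
    rw [DenseRange, Submodule.coe_subtype, Subtype.range_coe]
    exact MatrixWeights.dense_finiteHaar n
  refine ⟨S.extendOfNorm (MatrixWeights.finiteHaar n).subtype, fun f hf => ?_, fun T hT => ?_⟩
  · have h := S.extendOfNorm_eq hdense hSM ⟨f, hf⟩
    rw [Submodule.subtype_apply] at h
    rw [h]
    exact (hmem ⟨f, hf⟩).coeFn_toLp
  -- Uniqueness: two continuous maps that agree on the dense subspace of finite Haar sums coincide.
  · refine ContinuousLinearMap.ext fun f => ?_
    refine congrFun (hdense.equalizer T.continuous
      (S.extendOfNorm (MatrixWeights.finiteHaar n).subtype).continuous (funext fun g => ?_)) f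
    rw [Function.comp_apply, Function.comp_apply, S.extendOfNorm_eq hdense hSM]
    exact Lp.ext ((hT g.1 g.2).trans (hmem g).coeFn_toLp.symm)
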